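/- Setting. Let $D_0$ be a finite nonempty set and $K\ge 1$. A reward $f$ on $D_0$ is drawn from a Gaussian process with mean zero and known kernel $k_0$ with $k_0(x,x)=1$. The domain is $D=D_0\times\{1,\dots,K\}$, with $|D|\ge 2$, and $f(x,k)=f(x)$: querying $(x,k)$ returns $f(x)$ plus independent $N(0,\sigma^2(k))$ noise and costs $c(k)$, where $\sigma^2(k)>0$ and $c(k)>0$. Let $\mu_t,\sigma_t^2$ be the posterior mean and variance on $D$ after $t$ queries, and $\sigma^2_{t|S}$ the posterior variance after additionally querying the points of a finite collection $S$ (repetitions allowed). Assume that $S\mapsto \sigma_t^2(z)-\sigma_{t|S}^2(z)$ is submodular for all $z\in D$, all $t$ and all first $t$ queries. Algorithm (TruVaR). Parameters: $\overline\delta>0$, $\beta_{(i)}>0$ and $\eta_{(i)}=2^{-(i-1)}$ for $i\ge1$. The task is either Bayesian optimization (BO) or level-set estimation (LSE) with threshold $h$. Start with $i=1$, $M_0=D$, $H_0=L_0=\emptyset$. At time $t=1,2,\dots$ query an $$x_t\in\arg\max_{x\in D}\frac{1}{c(x)}\sum_{z\in M_{t-1}}\Big(\max\{\beta_{(i)}\sigma_{t-1}^2(z),\eta_{(i)}^2\}-\max\{\beta_{(i)}\sigma_{t-1|x}^2(z),\eta_{(i)}^2\}\Big),$$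 where $c((x_0,k))=c(k)$ and ties are broken by any rule that uses only past observations. With $u_t,\ell_t=\mu_t\pm\beta_{(i)}^{1/2}\sigma_t$, set $M_t=\{x\in M_{t-1}:u_t(x)\ge\max_{z\in M_{t-1}}\ell_t(z)\}$ (BO), or $M_t=\{x\in M_{t-1}:\ell_t(x)\le h\le u_t(x)\}$, $H_t=H_{t-1}\cup\{x\in M_{t-1}:\ell_t(x)>h\}$, $L_t=L_{t-1}\cup\{x\in M_{t-1}:u_t(x)<h\}$ (LSE). Then, while $M_t\ne\emptyset$ and $\max_{x\in M_t}\beta_{(i)}^{1/2}\sigma_t(x)\le(1+\overline\delta)\eta_{(i)}$, increase $i$ by one. The cumulative cost is $C_t=\sum_{t'\le t}c(x_{t'})$. The state at time $t$ is $\epsilon$-accurate if, for BO, $M_t$ contains all maximizers $x^*$ of $f$ and $f(x^*)-f(x)\le\epsilon$ for all $x\in M_t$; for LSE, if $f>h$ on $H_t$, $f<h$ on $L_t$, and $|f-h|\le\epsilon/2$ on $M_t$. Bound. Let $c_{\min}=\min_k c(k)$ and $c_{\max}=\max_k c(k)$. Fix $\delta\in(0,1)$ and $\epsilon>0$ with $\max\{1,\overline\delta\}\,\epsilon\le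 4(1+\overline\delta)$. Let $\beta_T=2\log\frac{|D|T^2c_{\max}^2\pi^2}{6\delta c_{\min}^2}$, let $\gamma_T(\sigma^2)=\max_{x_1,\dots,x_T\in D_0}\frac12\log\det(I_T+\sigma^{-2}[k_0(x_i,x_j)]_{i,j})$, and let $T^*(k)$ be the smallest integer $T\ge1$ such that, with $\sigma^2=\sigma^2(k)$ and $\gamma_T=\gamma_T(\sigma^2(k))$, $$T\ge\Big(2\sigma^2\gamma_T\beta_T\frac{96(1+\overline\delta)^2}{\epsilon^2}+\frac{\gamma_T\beta_T}{\log(1+\sigma^{-2})}\cdot\frac{6(1+\overline\delta)^2}{\sigma^2}+2\max\Big\{0,\Big\lceil\log_2\frac{32(1+\overline\delta)^2}{\epsilon\sigma}\Big\rceil\Big\}\Big)\log\frac{16(1+\overline\delta)^2|D|\beta_T}{\overline\delta^2\epsilon^2}.$$ Corollary 3. There are choices of $\beta_{(i)}$, bounded below by a positive constant and fixed in advance (they depend neither on time nor on the task, the reward or the observations), such that, for each task, with probability at least $1-\delta$ the state is $\epsilon$-accurate at every time $t$ with $C_t\ge\min_k c(k)T^*(k)$. -/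

import Mathlib

open MeasureTheory ProbabilityTheory

namespace TruVaR

noncomputable section

/-! ### Gaussian process posterior -/

section Posterior

variable {D : Type*}

/-- The matrix `K + Σ` of a list of query points: kernel matrix plus diagonal noise. -/
def noisyGram (k : D → D → ℝ) (noiseVar : D → ℝ) (l : List D) :
    Matrix (Fin l.length) (Fin l.length) ℝ :=
  Matrix.of (fun i j => k (l.get i) (l.get j)) + Matrix.diagonal (fun i => noiseVar (l.get i))

/-- The vector of covariances between the queried points and `x`. -/
def kernelVec (k : D → D → ℝ) (l : List D) (x : D) : Fin l.length → ℝ :=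
  fun i => k (l.get i) x

/-- Posterior mean at `x`, when the `i`-th point of `l` produced the observation `y i`. -/
def postMean (k : D → D → ℝ) (noiseVar : D → ℝ) (l : List D) (y : ℕ → ℝ) (x : D) : ℝ :=
  kernelVec k l x ⬝ᵥ ((noisyGram k noiseVar l)⁻¹.mulVec (fun i => y i))

/-- Posterior variance at `x` after observing the points of `l`. -/
def postVar (k : D → D → ℝ) (noiseVar : D → ℝ) (l : List D) (x : D) : ℝ :=
  k x x - kernelVec k l x ⬝ᵥ ((noisyGram k noiseVar l)⁻¹.mulVec (kernelVec k l x))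

/-- Posterior standard deviation. -/
def postStd (k : D → D → ℝ) (noiseVar : D → ℝ) (l : List D) (x : D) : ℝ :=
  √(postVar k noiseVar l x)

/-- Variance reduction at `x` from observing the points of `S` in addition to those of `past`. -/
def varReduction (k : D → D → ℝ) (noiseVar : D → ℝ) (past : List D) (x : D) (S : List D) : ℝ :=
  postVar k noiseVar past x - postVar k noiseVar (past ++ S) x

/-- Submodularity (diminishing returns) of the variance reduction, as a function of a collection
of points with duplicates allowed, for all past points and all target points `x`.
`S.Subperm S'` is inclusion of multisets. -/
def SubmodularVarReduction (k : D → D → ℝ) (noiseVar : D → ℝ) : Prop :=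
  ∀ (past : List D) (x : D) (S S' : List D), S.Subperm S' → ∀ p : D,
    varReduction k noiseVar past x (S' ++ [p]) - varReduction k noiseVar past x S' ≤
      varReduction k noiseVar past x (S ++ [p]) - varReduction k noiseVar past x S

end Posterior

/-! ### The algorithm -/

/-- The two problems: Bayesian optimization, or level-set estimation with threshold `h`. -/
inductive Task where
  | bo : Task
  | lse (h : ℝ) : Task

/-- The input of the algorithm. Epochs are numbered from `0`, so that `β i` and
`η₁ * r ^ i` are the parameters of the `(i+1)`-st epoch. -/
structure Input (D : Type*) where
  /-- the kernel -/
  kernel : D → D → ℝ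
  /-- the noise variance of each point -/
  noiseVar : D → ℝ
  /-- the cost of each point -/
  cost : D → ℝ
  /-- the problem to solve -/
  task : Task
  /-- slack in the end-of-epoch test -/
  δbar : ℝ
  /-- factor by which the target confidence shrinks -/
  r : ℝ
  /-- target confidence of the first epoch -/
  η₁ : ℝ
  /-- squared confidence widths -/
  β : ℕ → ℝ

/-- The state of the algorithm after a time step: current epoch, and the sets `M`, `H`, `L`. -/
structure State (D : Type*) where
  /-- current epoch -/
  epoch : ℕ
  /-- potential maximizers, or unclassified points -/
  M : Finset D
  /-- points classified as above the threshold -/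
  H : Finset D
  /-- points classified as below the threshold -/
  L : Finset D

namespace Input

variable {D : Type*} (A : Input D)

/-- Target confidence of an epoch. -/
def η (i : ℕ) : ℝ := A.η₁ * A.r ^ i

/-- Upper confidence bound with the parameter of epoch `i`. -/
def ucb (i : ℕ) (l : List D) (y : ℕ → ℝ) (x : D) : ℝ :=
  postMean A.kernel A.noiseVar l y x + √(A.β i) * postStd A.kernel A.noiseVar l x

/-- Lower confidence bound with the parameter of epoch `i`. -/
def lcb (i : ℕ) (l : List D) (y : ℕ → ℝ) (x : D) : ℝ :=
  postMean A.kernel A.noiseVar l y x - √(A.β i) * postStd A.kernel A.noiseVar l x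

/-- The acquisition function: decrease of the truncated variances over `M`, per unit cost, from
querying `x` after the points of `l`. -/
def acquisition (i : ℕ) (M : Finset D) (l : List D) (x : D) : ℝ :=
  (∑ z ∈ M, max (A.β i * postVar A.kernel A.noiseVar l z) (A.η i ^ 2) -
    ∑ z ∈ M, max (A.β i * postVar A.kernel A.noiseVar (l ++ [x]) z) (A.η i ^ 2)) / A.cost x

/-- The test for ending epoch `i`: the confidence of all points of `M` is at most
`(1 + δbar) * η i`. -/
def EpochDone (i : ℕ) (M : Finset D) (l : List D) : Prop :=
  ∀ x ∈ M, √(A.β i) * postStd A.kernel A.noiseVar l x ≤ (1 + A.δbar) * A.η i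

open Classical in
/-- The while loop: starting from epoch `i`, move to the first epoch whose test fails.
(If there is none, which includes the case that `M` is empty and nothing is left to be done,
the epoch is kept.) -/
def nextEpoch (i : ℕ) (M : Finset D) (l : List D) : ℕ :=
  if h : ∃ j, i ≤ j ∧ ¬ A.EpochDone j M l then Nat.find h else i

open Classical in
/-- One update of the state, where `l` and `y` are all points and observations so far. -/
def update (s : State D) (l : List D) (y : ℕ → ℝ) : State D :=
  let u := A.ucb s.epoch l y
  let ℓ := A.lcb s.epoch l y
  match A.task with
  | Task.bo =>
      let M' := s.M.filter (fun x => ∀ z ∈ s.M, ℓ z ≤ u x)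
      { epoch := A.nextEpoch s.epoch M' l, M := M', H := s.H, L := s.L }
  | Task.lse h =>
      let M' := s.M.filter (fun x => h ≤ u x ∧ ℓ x ≤ h)
      { epoch := A.nextEpoch s.epoch M' l
        M := M'
        H := s.H ∪ s.M.filter (fun x => h < ℓ x)
        L := s.L ∪ s.M.filter (fun x => u x < h) }

end Input

/-- The first `t` query points. The `(t+1)`-st point queried is `x t`. -/
def history {D : Type*} (x : ℕ → D) (t : ℕ) : List D := (List.range t).map x

/-- The state after `t` time steps, given the sequences of queries and of observations
(of which only the first `t` terms matter). -/
def Input.state {D : Type*} [Fintype D] (A : Input D) (x : ℕ → D) (y : ℕ → ℝ) : ℕ → State D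
  | 0 => { epoch := 0, M := Finset.univ, H := ∅, L := ∅ }
  | t + 1 => A.update (Input.state A x y t) (history x (t + 1)) y

/-- The selection rule: every query maximizes the acquisition function over the whole domain. -/
def Input.GreedySelection {D : Type*} [Fintype D] (A : Input D) (x : ℕ → D) (y : ℕ → ℝ) : Prop :=
  ∀ (t : ℕ) (x' : D),
    A.acquisition (A.state x y t).epoch (A.state x y t).M (history x t) x' ≤
      A.acquisition (A.state x y t).epoch (A.state x y t).M (history x t) (x t)

/-- Cumulative cost after `t` time steps. -/
def cumCost {D : Type*} (cost : D → ℝ) (x : ℕ → D) (t : ℕ) : ℝ :=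
  ∑ i ∈ Finset.range t, cost (x i)

/-- `ε`-accuracy of a state with respect to the reward function `f`. -/
def EpsAccurate {D : Type*} (f : D → ℝ) (ε : ℝ) (s : State D) : Task → Prop
  | Task.bo =>
      (∀ x, (∀ z, f z ≤ f x) → x ∈ s.M) ∧ (∀ x ∈ s.M, ∀ z, (∀ w, f w ≤ f z) → f z - f x ≤ ε)
  | Task.lse h =>
      (∀ x ∈ s.H, h < f x) ∧ (∀ x ∈ s.L, f x < h) ∧ (∀ x ∈ s.M, |f x - h| ≤ ε / 2)

/-! ### The probabilistic model -/

section Model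

variable {D : Type*} {Ω : Type*} [MeasurableSpace Ω]

/-- `f` is a Gaussian process with mean zero and covariance function `k`. -/
structure IsCenteredGP (k : D → D → ℝ) (f : D → Ω → ℝ) (P : Measure Ω) : Prop where
  measurable : ∀ x, Measurable (f x)
  gaussian : IsGaussianProcess f P
  mean_zero : ∀ x, ∫ ω, f x ω ∂P = 0
  covariance : ∀ x x', cov[f x, f x'; P] = k x x'

/-- `w` is a sequence of independent standard Gaussians, independent of the function `f`. -/
structure IsStdNoise {E : Type*} (w : ℕ → Ω → ℝ) (f : E → Ω → ℝ) (P : Measure Ω) : Prop where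
  measurable : ∀ t, Measurable (w t)
  gaussian : ∀ t, P.map (w t) = gaussianReal 0 1
  indep : iIndepFun w P
  indep_f : IndepFun (fun ω t => w t ω) (fun ω x => f x ω) P

/-- `x`, `y` are the queries and observations of a run of the algorithm on the reward `f`:
the observation at time `t` is `f (x t)` plus Gaussian noise of variance `noiseVar (x t)`; each
query maximizes the acquisition function; and it is determined by the previous observations (so
ties between maximizers may be broken in any way that uses only these). -/
structure IsRun [Fintype D] (A : Input D) (f : D → Ω → ℝ) (w : ℕ → Ω → ℝ)
    (x : ℕ → Ω → D) (y : ℕ → Ω → ℝ) : Prop where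
  observation : ∀ t ω, y t ω = f (x t ω) ω + √(A.noiseVar (x t ω)) * w t ω
  greedy : ∀ ω, A.GreedySelection (fun t => x t ω) (fun t => y t ω)
  causal : ∀ t d,
    MeasurableSet[⨆ s : Fin t, MeasurableSpace.comap (y s) inferInstance] {ω | x t ω = d}

end Model

/-- The algorithm's input when the noise level can be chosen: the domain is `D₀ × {1, …, K}`, the
reward and its kernel depend on the point of `D₀` only, and the noise variance and the cost depend
on the noise level only. The first target confidence is `1`, and it is halved between epochs. -/
def chooseNoiseInput {D₀ : Type*} {K : ℕ} (k₀ : D₀ → D₀ → ℝ) (σ2 c : Fin K → ℝ) (task : Task)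
    (δbar : ℝ) (β : ℕ → ℝ) : Input (D₀ × Fin K) where
  kernel p q := k₀ p.1 q.1
  noiseVar p := σ2 p.2
  cost p := c p.2
  task := task
  δbar := δbar
  r := 1 / 2
  η₁ := 1
  β := β

/-! ### The quantities in the bound -/

/-- Maximum mutual information of `T` observations with noise variance `σ2`. -/
def maxInfoGain {D₀ : Type*} (k : D₀ → D₀ → ℝ) (σ2 : ℝ) (T : ℕ) : ℝ :=
  ⨆ x : Fin T → D₀,
    1 / 2 * Real.log (1 + σ2⁻¹ • Matrix.of (fun i j => k (x i) (x j))).det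

/-- `2 log (N T² R² π² / (6 δ))`, where `N` is the size of the domain and `R` is the ratio of the
maximum cost to the minimum cost. -/
def betaT (N : ℕ) (R δ : ℝ) (T : ℕ) : ℝ :=
  2 * Real.log (N * (T : ℝ) ^ 2 * R ^ 2 * Real.pi ^ 2 / (6 * δ))

/-- The condition on the time horizon `T` for the noise variance `σ2`, the maximum mutual
information `γ` and the confidence parameter `β` (both at `T`), and the size `N` of the domain.
The rounded-up logarithm, a bound on a number of epochs, is read as `0` where it is negative:
`⌈·⌉₊` is the maximum of `0` and the ceiling. -/
def HorizonCondition (σ2 γ β δbar ε : ℝ) (N T : ℕ) : Prop :=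
  (2 * σ2 * γ * β * (96 * (1 + δbar) ^ 2 / ε ^ 2)
      + 1 / Real.log (1 + σ2⁻¹) * γ * β * (6 * (1 + δbar) ^ 2 / σ2)
      + 2 * (⌈Real.logb 2 (32 * (1 + δbar) ^ 2 / (ε * √σ2))⌉₊ : ℝ))
    * Real.log (16 * (1 + δbar) ^ 2 * N * β / (δbar ^ 2 * ε ^ 2)) ≤ T

/-- The smallest `T ≥ 1` such that the horizon condition holds with the noise variance `σ2`. -/
def minHorizon {D₀ : Type*} (k : D₀ → D₀ → ℝ) (N : ℕ) (R δ δbar ε σ2 : ℝ) : ℕ :=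
  sInf {T : ℕ | 1 ≤ T ∧
    HorizonCondition σ2 (maxInfoGain k σ2 T) (betaT N R δ T) δbar ε N T}

end

end TruVaR

/-! The proof combines a deterministic bound on the cost of each epoch with a confidence band that
holds at all times, and then chooses the confidence parameters so that the two are compatible.

Cost. In an epoch with target `η` and parameter `β`, the potential is the sum over `M` of the excess
of `β σ²` over `η²`. Suppose that some collection `S` of cost `C` brings `β σ²` below `η²`
everywhere. By submodularity the gains of the single points of `S` add up to at least the potential,
so the greedy query removes at least a fraction `1 / C` of it per unit cost, and the potential
decays like `exp (-cost / C)` (`potential_append_le`). While the epoch's test fails the potential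
exceeds `(2 δbar + δbar²) η²`, so the epoch costs at most `C` times a logarithm
(`EpochBudget.cumCost_le`). A cheap `S` exists because `n` observations at one noise level, all at
points of current variance above `v`, would carry more than `n / 2 * log (1 + v / σ²)` of mutual
information, which the maximum information gain forbids (`exists_cover`). Over the epochs up to the
first `m` with `4 (1 + δbar) 2⁻ᵐ ≤ ε` these numbers form a geometric sum, and with rounding they fit
into the bracket of the horizon condition (`sum_queries_le`).

Confidence. On the event that the queries form a fixed list, the posterior mean is a fixed linear
predictor. Its error is Gaussian and independent of the observations of that list, and these
observations determine the event. Hence the Gaussian tail bound survives adaptive sampling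
(`measure_posterior_deviation_le`). A union bound with `∑ 1 / t² = π² / 6` covers all points and
times.

Parameters. The band at time `t` needs `β ≥ 2 log (N t² π² / (6 δ))`; `t` is at most the cost
divided by `cmin`, and the cost budget itself grows with `β`. Up to epoch `m` the constant value
`betaT` at the best horizon works, by the horizon condition. For a later epoch the total budget is
polynomial in its own `β` while the requirement is logarithmic, so a large `β` works; the later
values are chosen recursively, before any data (`exists_parameterChoice`).

Once the cost reaches the bound, either `M` is empty or epoch `m` is over, and intervals of width `ε
/ 2` give accuracy (`Input.epsAccurate`). -/

namespace TruVaR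

/-! ### Posterior variance as the minimal risk of linear prediction -/

section PosteriorAlgebra

variable {D : Type*} {k : D → D → ℝ} {noiseVar : D → ℝ}

theorem noisyGram_posDef (hk : (Matrix.of k).PosSemidef) (hn : ∀ x, 0 < noiseVar x) (l : List D) :
    (noisyGram k noiseVar l).PosDef :=
  Matrix.PosDef.posSemidef_add (hk.submatrix l.get) (Matrix.PosDef.diagonal fun i => hn (l.get i))

theorem isUnit_det_noisyGram (hk : (Matrix.of k).PosSemidef) (hn : ∀ x, 0 < noiseVar x)
    (l : List D) : IsUnit (noisyGram k noiseVar l).det :=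
  (noisyGram_posDef hk hn l).det_pos.ne'.isUnit

theorem kernel_symm (hk : (Matrix.of k).PosSemidef) (x y : D) : k x y = k y x := by
  simpa using (hk.isHermitian.apply y x)

/-- The coefficients of the best linear predictor of the value at `z`. -/
noncomputable def predWeights (k : D → D → ℝ) (noiseVar : D → ℝ) (l : List D) (z : D) :
    Fin l.length → ℝ :=
  (noisyGram k noiseVar l)⁻¹.mulVec (kernelVec k l z)

/-- The mean squared error of the linear predictor with coefficients `a`. -/
noncomputable def predRisk (k : D → D → ℝ) (noiseVar : D → ℝ) (l : List D) (z : D)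
    (a : Fin l.length → ℝ) : ℝ :=
  k z z - 2 * ∑ i, a i * k (l.get i) z + ∑ i, ∑ j, a i * (a j * k (l.get i) (l.get j))
    + ∑ i, a i * (a i * noiseVar (l.get i))

theorem predRisk_eq (l : List D) (z : D) (a : Fin l.length → ℝ) :
    predRisk k noiseVar l z a =
      k z z - 2 * (a ⬝ᵥ kernelVec k l z) + a ⬝ᵥ (noisyGram k noiseVar l).mulVec a := by
  have h : a ⬝ᵥ (noisyGram k noiseVar l).mulVec a =
      ∑ i, ∑ j, a i * (a j * k (l.get i) (l.get j)) + ∑ i, a i * (a i * noiseVar (l.get i)) := by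
    rw [noisyGram, Matrix.add_mulVec, dotProduct_add]
    congr 1
    · simp only [dotProduct, Matrix.mulVec, Matrix.of_apply, Finset.mul_sum]
      exact Finset.sum_congr rfl fun i _ => Finset.sum_congr rfl fun j _ => by ring
    · simp only [dotProduct, Matrix.mulVec_diagonal]
      exact Finset.sum_congr rfl fun i _ => by ring
  rw [h, predRisk]
  simp only [dotProduct, kernelVec]
  ring

theorem noisyGram_mulVec_predWeights (hk : (Matrix.of k).PosSemidef) (hn : ∀ x, 0 < noiseVar x)
    (l : List D) (z : D) :
    (noisyGram k noiseVar l).mulVec (predWeights k noiseVar l z) = kernelVec k l z := by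
  rw [predWeights, Matrix.mulVec_mulVec, Matrix.mul_nonsing_inv _ (isUnit_det_noisyGram hk hn l),
    Matrix.one_mulVec]

/-- Completing the square in the coefficients. The posterior variance is thus the minimum of the
risk over all linear predictors, and upper bounds on it come from trial predictors. -/
theorem predRisk_eq_postVar_add (hk : (Matrix.of k).PosSemidef) (hn : ∀ x, 0 < noiseVar x)
    (l : List D) (z : D) (a : Fin l.length → ℝ) :
    predRisk k noiseVar l z a = postVar k noiseVar l z +
      (a - predWeights k noiseVar l z) ⬝ᵥ
        (noisyGram k noiseVar l).mulVec (a - predWeights k noiseVar l z) := by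
  have hG := noisyGram_mulVec_predWeights hk hn l z
  have hs : (noisyGram k noiseVar l).transpose = noisyGram k noiseVar l := by
    have := (noisyGram_posDef hk hn l).isHermitian
    rwa [Matrix.IsHermitian, Matrix.conjTranspose_eq_transpose_of_trivial] at this
  have hsym : predWeights k noiseVar l z ⬝ᵥ (noisyGram k noiseVar l).mulVec a
      = a ⬝ᵥ kernelVec k l z := by
    rw [Matrix.dotProduct_mulVec, ← Matrix.mulVec_transpose, hs, hG, dotProduct_comm]
  have hv : postVar k noiseVar l z = k z z - kernelVec k l z ⬝ᵥ predWeights k noiseVar l z := rfl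
  rw [predRisk_eq, hv, Matrix.mulVec_sub, dotProduct_sub, sub_dotProduct, sub_dotProduct, hG, hsym,
    dotProduct_comm (predWeights k noiseVar l z)]
  ring

theorem predRisk_predWeights (hk : (Matrix.of k).PosSemidef) (hn : ∀ x, 0 < noiseVar x)
    (l : List D) (z : D) :
    predRisk k noiseVar l z (predWeights k noiseVar l z) = postVar k noiseVar l z := by
  rw [predRisk_eq_postVar_add hk hn]; simp

theorem postVar_le_predRisk (hk : (Matrix.of k).PosSemidef) (hn : ∀ x, 0 < noiseVar x)
    (l : List D) (z : D) (a : Fin l.length → ℝ) :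
    postVar k noiseVar l z ≤ predRisk k noiseVar l z a := by
  rw [predRisk_eq_postVar_add hk hn]
  have := (noisyGram_posDef hk hn l).posSemidef.dotProduct_mulVec_nonneg
    (a - predWeights k noiseVar l z)
  rw [star_trivial] at this
  linarith

theorem postVar_le_prior (hk : (Matrix.of k).PosSemidef) (hn : ∀ x, 0 < noiseVar x)
    (l : List D) (z : D) : postVar k noiseVar l z ≤ k z z := by
  simpa [predRisk] using postVar_le_predRisk hk hn l z 0

/-- The risk of coefficients `a` is the kernel's quadratic form at `(a, -1)`, which is nonnegative,
plus the noise term, which is positive unless `a = 0`; for `a = 0` the risk is the prior variance.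
-/
theorem postVar_pos (hk : (Matrix.of k).PosSemidef) (hn : ∀ x, 0 < noiseVar x)
    (l : List D) (z : D) (hz : 0 < k z z) : 0 < postVar k noiseVar l z := by
  rw [← predRisk_predWeights hk hn]
  generalize predWeights k noiseVar l z = a
  by_cases ha : a = 0
  · subst ha; simpa [predRisk] using hz
  have h1 := (hk.submatrix (Sum.elim l.get fun _ : Unit => z)).dotProduct_mulVec_nonneg
    (Sum.elim a fun _ => -1)
  have h2 : 0 < ∑ i, a i * (a i * noiseVar (l.get i)) := by
    obtain ⟨i, hi⟩ := Function.ne_iff.1 ha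
    refine Finset.sum_pos' (fun j _ => ?_) ⟨i, Finset.mem_univ i, ?_⟩
    · rw [← mul_assoc]; exact mul_nonneg (mul_self_nonneg _) (hn _).le
    · rw [← mul_assoc]; exact mul_pos (mul_self_pos.2 hi) (hn _)
  have h3 : (star (Sum.elim a fun _ : Unit => (-1 : ℝ))) ⬝ᵥ
      ((Matrix.of k).submatrix (Sum.elim l.get fun _ : Unit => z)
        (Sum.elim l.get fun _ : Unit => z)).mulVec (Sum.elim a fun _ => -1) =
      k z z - 2 * ∑ i, a i * k (l.get i) z + ∑ i, ∑ j, a i * (a j * k (l.get i) (l.get j)) := by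
    rw [star_trivial]
    simp only [dotProduct, Matrix.mulVec, Fintype.sum_sum_type, Sum.elim_inl, Sum.elim_inr,
      Matrix.submatrix_apply, Matrix.of_apply, Finset.univ_unique, Finset.sum_singleton,
      mul_add, Finset.sum_add_distrib, Finset.mul_sum]
    have e1 : ∑ i, ∑ j, a i * (k (l.get i) (l.get j) * a j) =
        ∑ i, ∑ j, a i * (a j * k (l.get i) (l.get j)) :=
      Finset.sum_congr rfl fun i _ => Finset.sum_congr rfl fun j _ => by ring
    have e2 : ∑ i, -1 * (k z (l.get i) * a i) = ∑ i, a i * (k (l.get i) z * -1) :=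
      Finset.sum_congr rfl fun i _ => by rw [kernel_symm hk z]; ring
    have e3 : ∑ i, 2 * (a i * k (l.get i) z) = -2 * ∑ i, a i * (k (l.get i) z * -1) := by
      rw [Finset.mul_sum]
      exact Finset.sum_congr rfl fun i _ => by ring
    rw [e1, e2, e3]
    ring
  rw [h3] at h1
  rw [predRisk]
  linarith

/-- More observations can only decrease the posterior variance. -/
theorem postVar_le_of_sublist (hk : (Matrix.of k).PosSemidef) (hn : ∀ x, 0 < noiseVar x)
    {S l : List D} (h : S.Sublist l) (z : D) :
    postVar k noiseVar l z ≤ postVar k noiseVar S z := by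
  obtain ⟨e, he⟩ := List.sublist_iff_exists_fin_orderEmbedding_get_eq.1 h
  rw [← predRisk_predWeights hk hn S]
  generalize predWeights k noiseVar S z = a
  have hsum : ∀ F : Fin l.length → ℝ,
      ∑ j, Function.extend e a 0 j * F j = ∑ i, a i * F (e i) := fun F =>
    (Fintype.sum_of_injective e e.injective _ _
      (fun j hj => by
        rw [Function.extend_apply' _ _ _ (by simpa using hj)]; simp)
      (fun i => by rw [e.injective.extend_apply])).symm
  -- The optimal predictor from `S`, padded with zero coefficients, is a predictor from `l` with the
  -- same risk.
  refine (postVar_le_predRisk hk hn l z (Function.extend e a 0)).trans_eq ?_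
  simp only [predRisk, ← Finset.mul_sum, hsum, e.injective.extend_apply, ← he]

/-- The second factor is the Schur complement of the old Gram matrix in the new one. -/
theorem det_noisyGram_append_singleton (hk : (Matrix.of k).PosSemidef)
    (hn : ∀ x, 0 < noiseVar x) (l : List D) (x : D) :
    (noisyGram k noiseVar (l ++ [x])).det =
      (noisyGram k noiseVar l).det * (noiseVar x + postVar k noiseVar l x) := by
  let e : Fin l.length ⊕ Fin 1 ≃ Fin (l ++ [x]).length :=
    finSumFinEquiv.trans (finCongr (by simp))
  have hl : ∀ i : Fin l.length, (l ++ [x]).get (e (Sum.inl i)) = l.get i := fun i => by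
    simp [e]
  have hr : ∀ i : Fin 1, (l ++ [x]).get (e (Sum.inr i)) = x := fun i => by
    simp [e]
  have hb : (noisyGram k noiseVar (l ++ [x])).submatrix e e =
      Matrix.fromBlocks (noisyGram k noiseVar l)
        (Matrix.replicateCol (Fin 1) (kernelVec k l x))
        (Matrix.replicateRow (Fin 1) (kernelVec k l x))
        (Matrix.of fun _ _ => k x x + noiseVar x) := by
    ext i j
    simp only [noisyGram, Matrix.submatrix_apply, Matrix.add_apply, Matrix.of_apply,
      Matrix.diagonal_apply, EmbeddingLike.apply_eq_iff_eq]
    rcases i with i | i <;> rcases j with j | j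
    · simp only [hl]; simp [Matrix.diagonal_apply]
    · simp only [hl, hr]; simp [kernelVec]
    · simp only [hl, hr]; simp [kernelVec, kernel_symm hk x]
    · simp only [hr]; simp [Subsingleton.elim i j]
  have := (noisyGram k noiseVar l).invertibleOfIsUnitDet (isUnit_det_noisyGram hk hn l)
  rw [← Matrix.det_submatrix_equiv_self e, hb, Matrix.det_fromBlocks₁₁, Matrix.det_fin_one,
    Matrix.invOf_eq_nonsing_inv]
  congr 1
  rw [Matrix.mul_assoc]
  have : (Matrix.replicateRow (Fin 1) (kernelVec k l x) * ((noisyGram k noiseVar l)⁻¹ *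
      Matrix.replicateCol (Fin 1) (kernelVec k l x))) 0 0 =
      kernelVec k l x ⬝ᵥ (noisyGram k noiseVar l)⁻¹.mulVec (kernelVec k l x) := rfl
  rw [Matrix.sub_apply, this, postVar]
  simp only [Matrix.of_apply]
  ring

end PosteriorAlgebra

/-! ### Mutual information and its growth -/

section InformationGain

variable {D : Type*} {k : D → D → ℝ} {noiseVar : D → ℝ}

/-- The determinant whose logarithm is twice the mutual information of the observations of `l`. -/
noncomputable def infoDet (k : D → D → ℝ) (v : ℝ) (l : List D) : ℝ :=
  (1 + v⁻¹ • Matrix.of (fun i j => k (l.get i) (l.get j)) :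
    Matrix (Fin l.length) (Fin l.length) ℝ).det

theorem det_noisyGram_eq_infoDet {v : ℝ} (hv : 0 < v) {l : List D}
    (hl : ∀ p ∈ l, noiseVar p = v) :
    (noisyGram k noiseVar l).det = v ^ l.length * infoDet k v l := by
  have : noisyGram k noiseVar l =
      v • (1 + v⁻¹ • Matrix.of (fun i j => k (l.get i) (l.get j))) := by
    ext i j
    have hi := hl (l.get i) (List.get_mem l i)
    by_cases h : i = j
    · subst h
      simp only [noisyGram, Matrix.add_apply, Matrix.of_apply, Matrix.diagonal_apply_eq,
        Matrix.smul_apply, Matrix.one_apply_eq, smul_eq_mul, hi]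
      field_simp
      ring
    · simp only [noisyGram, Matrix.add_apply, Matrix.of_apply, Matrix.diagonal_apply_ne _ h,
        Matrix.smul_apply, Matrix.one_apply_ne h, smul_eq_mul]
      field_simp
      ring
  rw [this, Matrix.det_smul, Fintype.card_fin, infoDet]

theorem infoDet_pos (hk : (Matrix.of k).PosSemidef) {v : ℝ} (hv : 0 < v) (l : List D) :
    0 < infoDet k v l := by
  have h := (noisyGram_posDef (noiseVar := fun _ => v) hk (fun _ => hv) l).det_pos
  rw [det_noisyGram_eq_infoDet hv (fun _ _ => rfl)] at h
  exact (mul_pos_iff_of_pos_left (pow_pos hv _)).1 h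

theorem infoDet_append_singleton (hk : (Matrix.of k).PosSemidef) (hn : ∀ x, 0 < noiseVar x)
    {v : ℝ} (hv : 0 < v) {l : List D} (hl : ∀ p ∈ l, noiseVar p = v) {x : D}
    (hx : noiseVar x = v) :
    infoDet k v (l ++ [x]) = infoDet k v l * (1 + v⁻¹ * postVar k noiseVar l x) := by
  have h := det_noisyGram_append_singleton hk hn l x
  have hl' : ∀ p ∈ l ++ [x], noiseVar p = v := by
    intro p hp
    rcases List.mem_append.1 hp with hp | hp
    · exact hl p hp
    · rw [List.mem_singleton.1 hp, hx]
  rw [det_noisyGram_eq_infoDet hv hl, det_noisyGram_eq_infoDet hv hl', hx, List.length_append,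
    List.length_singleton, pow_succ] at h
  have h0 := pow_pos hv l.length
  field_simp
  have : v ^ l.length * (infoDet k v (l ++ [x]) * v) =
    v ^ l.length * (infoDet k v l * (v + postVar k noiseVar l x)) := by linarith
  exact mul_left_cancel₀ h0.ne' this

theorem infoDet_nil (v : ℝ) : infoDet k v [] = 1 := by
  simp [infoDet]

theorem infoDet_ofFn (v : ℝ) {n : ℕ} (x : Fin n → D) :
    infoDet k v (List.ofFn x) =
      (1 + v⁻¹ • Matrix.of (fun i j => k (x i) (x j)) : Matrix (Fin n) (Fin n) ℝ).det := by
  rw [infoDet, ← Matrix.det_submatrix_equiv_self (finCongr (List.length_ofFn (f := x)))]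
  congr 1
  ext i j
  simp only [Matrix.submatrix_apply, Matrix.add_apply, Matrix.smul_apply, Matrix.of_apply,
    List.get_ofFn, Matrix.one_apply, Fin.cast_inj, finCongr_apply]

/-- The map `g` serves lists of pairs of a point and a noise level, whose kernel sees the point
only. -/
theorem log_infoDet_le_maxInfoGain [Finite D] {D' : Type*} (g : D' → D) (v : ℝ) (l : List D') :
    Real.log (infoDet (fun p q => k (g p) (g q)) v l) ≤ 2 * maxInfoGain k v l.length := by
  have := le_ciSup (f := fun x : Fin l.length → D =>
    1 / 2 * Real.log (1 + v⁻¹ • Matrix.of (fun i j => k (x i) (x j))).det)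
    (Set.finite_range _).bddAbove (fun i => g (l.get i))
  rw [maxInfoGain]
  simp only [infoDet]
  linarith

theorem one_add_mul_postVar_gt_one (hk : (Matrix.of k).PosSemidef) (hn : ∀ x, 0 < noiseVar x)
    (h1 : ∀ x, k x x = 1) {v : ℝ} (hv : 0 < v) (l : List D) (x : D) :
    1 < 1 + v⁻¹ * postVar k noiseVar l x := by
  have := mul_pos (inv_pos.2 hv) (postVar_pos hk hn l x (by rw [h1]; exact one_pos))
  linarith

theorem maxInfoGain_le_succ [Finite D] [Nonempty D] (hk : (Matrix.of k).PosSemidef)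
    (h1 : ∀ x, k x x = 1) {v : ℝ} (hv : 0 < v) (n : ℕ) :
    maxInfoGain k v n ≤ maxInfoGain k v (n + 1) := by
  refine ciSup_le fun x => ?_
  obtain ⟨p⟩ := ‹Nonempty D›
  have h := log_infoDet_le_maxInfoGain (k := k) id v (List.ofFn x ++ [p])
  rw [List.length_append, List.length_ofFn, List.length_singleton] at h
  simp only [id] at h
  rw [infoDet_append_singleton (noiseVar := fun _ => v) hk (fun _ => hv) hv (fun _ _ => rfl) rfl]
    at h
  have h2 := one_add_mul_postVar_gt_one (noiseVar := fun _ => v) hk (fun _ => hv) h1 hv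
    (List.ofFn x) p
  rw [Real.log_mul (infoDet_pos hk hv _).ne' (by linarith), infoDet_ofFn] at h
  have h3 := Real.log_pos h2
  linarith

theorem maxInfoGain_mono [Finite D] [Nonempty D] (hk : (Matrix.of k).PosSemidef)
    (h1 : ∀ x, k x x = 1) {v : ℝ} (hv : 0 < v) : Monotone (maxInfoGain k v) :=
  monotone_nat_of_le_succ (maxInfoGain_le_succ hk h1 hv)

/-- The right side at `n = 1` is already this large. The bound lets all later estimates treat the
information gain as at least a fixed positive amount. -/
theorem half_log_le_maxInfoGain [Finite D] [Nonempty D] (hk : (Matrix.of k).PosSemidef)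
    (h1 : ∀ x, k x x = 1) {v : ℝ} (hv : 0 < v) {n : ℕ} (hn : 1 ≤ n) :
    1 / 2 * Real.log (1 + v⁻¹) ≤ maxInfoGain k v n := by
  refine le_trans ?_ (maxInfoGain_mono hk h1 hv hn)
  obtain ⟨p⟩ := ‹Nonempty D›
  have h := log_infoDet_le_maxInfoGain (k := k) id v ([] ++ [p])
  simp only [id] at h
  rw [infoDet_append_singleton (noiseVar := fun _ => v) hk (fun _ => hv) hv (fun _ _ => rfl) rfl,
    infoDet_nil] at h
  simp [postVar, h1, dotProduct] at h
  linarith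

theorem log_one_add_le_two_mul_sqrt {u : ℝ} (hu : 0 ≤ u) : Real.log (1 + u) ≤ 2 * √u := by
  have h1 : Real.log (1 + u) ≤ Real.log ((1 + √u) ^ 2) := by
    refine Real.log_le_log (by linarith) ?_
    nlinarith [Real.sq_sqrt hu, Real.sqrt_nonneg u]
  rw [Real.log_pow] at h1
  have h2 := Real.log_le_sub_one_of_pos (show 0 < 1 + √u by positivity)
  push_cast at h1
  linarith

/-- The mutual information of `n` observations grows at most like `√n` on a finite domain. -/
theorem exists_maxInfoGain_le_mul_sqrt [Fintype D] [Nonempty D] (hk : (Matrix.of k).PosSemidef)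
    {v : ℝ} (hv : 0 < v) :
    ∃ A : ℝ, 0 < A ∧ ∀ n : ℕ, 1 ≤ n → maxInfoGain k v n ≤ A * √n := by
  classical
  set N := Fintype.card D with hN
  have hN0 : 0 < N := Fintype.card_pos
  obtain ⟨B, hB⟩ := (Set.finite_range fun p : D × D => |k p.1 p.2|).bddAbove
  have hB' : ∀ a b, |k a b| ≤ B := fun a b => hB ⟨(a, b), rfl⟩
  have hB0 : 0 ≤ B := by
    obtain ⟨p⟩ := ‹Nonempty D›
    exact (abs_nonneg _).trans (hB' p p)
  have hf : (0 : ℝ) ≤ Real.log N.factorial := Real.log_natCast_nonneg _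
  refine ⟨1 / 2 * (Real.log N.factorial + N * (2 * √(v⁻¹ * B))) + 1, by positivity, fun n hn => ?_⟩
  refine ciSup_le fun x => ?_
  -- `Z` records which point each index queries, so that the `n × n` kernel matrix factors through
  -- the finite domain.
  let Z : Matrix (Fin n) D ℝ := Matrix.of fun i a => if x i = a then 1 else 0
  have hfac : (v⁻¹ • Matrix.of (fun i j => k (x i) (x j)) : Matrix (Fin n) (Fin n) ℝ) =
      (v⁻¹ • (Z * Matrix.of k)) * Z.transpose := by
    ext i j
    simp [Z, Matrix.mul_apply]
  have hdet : (1 + v⁻¹ • Matrix.of (fun i j => k (x i) (x j)) : Matrix (Fin n) (Fin n) ℝ).det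
      ≤ N.factorial * (1 + v⁻¹ * B * n) ^ N := by
    -- Swapping the factors turns the determinant into one of fixed size `N` with entries of order
    -- `n`. It is therefore polynomial in `n`, and its logarithm is below a multiple of `√n`.
    rw [hfac, Matrix.det_one_add_mul_comm]
    refine (le_abs_self _).trans ?_
    have := Matrix.det_le (A := 1 + Z.transpose * (v⁻¹ • (Z * Matrix.of k)))
      (abv := AbsoluteValue.abs) (x := 1 + v⁻¹ * B * n) ?_
    · simpa [nsmul_eq_mul] using this
    intro a b
    rw [AbsoluteValue.abs_apply, Matrix.add_apply]
    refine (abs_add_le _ _).trans (add_le_add ?_ ?_)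
    · by_cases h : a = b
      · subst h; rw [Matrix.one_apply_eq, abs_one]
      · rw [Matrix.one_apply_ne h, abs_zero]; exact zero_le_one
    · have : (Z.transpose * (v⁻¹ • (Z * Matrix.of k))) a b =
          ∑ i, (if x i = a then v⁻¹ * k (x i) b else 0) := by
        simp [Z, Matrix.mul_apply]
      rw [this]
      refine (Finset.abs_sum_le_sum_abs _ _).trans ?_
      have : ∀ i ∈ Finset.univ, |if x i = a then v⁻¹ * k (x i) b else 0| ≤ v⁻¹ * B := by
        intro i _
        split_ifs
        · rw [abs_mul, abs_of_pos (inv_pos.2 hv)]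
          exact mul_le_mul_of_nonneg_left (hB' _ _) (inv_pos.2 hv).le
        · rw [abs_zero]; positivity
      refine (Finset.sum_le_sum this).trans_eq ?_
      rw [Finset.sum_const, Finset.card_univ, Fintype.card_fin, nsmul_eq_mul]
      ring
  have hpos : 0 < (1 + v⁻¹ • Matrix.of (fun i j => k (x i) (x j)) :
      Matrix (Fin n) (Fin n) ℝ).det := by
    rw [← infoDet_ofFn]; exact infoDet_pos hk hv _
  have h1 := Real.log_le_log hpos hdet
  have h2 : 0 < 1 + v⁻¹ * B * n := by positivity
  rw [Real.log_mul (by positivity) (by positivity), Real.log_pow] at h1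
  have h3 := log_one_add_le_two_mul_sqrt (u := v⁻¹ * B * n) (by positivity)
  rw [Real.sqrt_mul (by positivity)] at h3
  have h4 : 1 ≤ √(n : ℝ) := by
    rw [Real.one_le_sqrt]; exact_mod_cast hn
  have h5 : (N : ℝ) * Real.log (1 + v⁻¹ * B * n) ≤ N * (2 * (√(v⁻¹ * B) * √n)) :=
    mul_le_mul_of_nonneg_left h3 (Nat.cast_nonneg _)
  have h6 : Real.log N.factorial ≤ Real.log N.factorial * √n := le_mul_of_one_le_right hf h4
  nlinarith

end InformationGain

/-! ### Reducing all variances with observations at one noise level -/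

section Cover

variable {D₀ : Type*} {K : ℕ} {k₀ : D₀ → D₀ → ℝ} {σ2 : Fin K → ℝ}

theorem liftKernel_posSemidef (hk : (Matrix.of k₀).PosSemidef) :
    (Matrix.of fun p q : D₀ × Fin K => k₀ p.1 q.1).PosSemidef :=
  hk.submatrix Prod.fst

/-- If `n` observations cannot carry enough information to have all been made at points of
variance above `v`, then `n` observations at a single noise level suffice to bring the variance
of all points down to `v`. -/
theorem exists_cover [Finite D₀] [Nonempty D₀] (hk : (Matrix.of k₀).PosSemidef)
    (hσ : ∀ j, 0 < σ2 j) (j : Fin K) {v : ℝ} (hv : 0 ≤ v) {n : ℕ} (hn : 1 ≤ n)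
    (h : 2 * maxInfoGain k₀ (σ2 j) n ≤ n * Real.log (1 + (σ2 j)⁻¹ * v)) :
    ∃ l : List (D₀ × Fin K), l.length = n ∧ (∀ p ∈ l, p.2 = j) ∧
      ∀ z, postVar (fun p q : D₀ × Fin K => k₀ p.1 q.1) (fun p => σ2 p.2) l z ≤ v := by
  set k := fun p q : D₀ × Fin K => k₀ p.1 q.1 with hkdef
  have hk' : (Matrix.of k).PosSemidef := liftKernel_posSemidef hk
  have hσ' : ∀ p : D₀ × Fin K, 0 < (fun p : D₀ × Fin K => σ2 p.2) p := fun p => hσ p.2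
  -- Always query a point whose variance exceeds `v`; each such query multiplies the determinant by
  -- more than `1 + v / σ²`. Once no such point is left the list is padded to the required length.
  -- The inequality is strict only from the first query on, and strictness is what contradicts the
  -- hypothesis at `m = n`.
  have key : ∀ m : ℕ, ∃ l : List (D₀ × Fin K), l.length = m ∧ (∀ p ∈ l, p.2 = j) ∧
      ((∀ z, postVar k (fun p => σ2 p.2) l z ≤ v) ∨
        (m * Real.log (1 + (σ2 j)⁻¹ * v) ≤ Real.log (infoDet k (σ2 j) l) ∧
          (1 ≤ m → m * Real.log (1 + (σ2 j)⁻¹ * v) < Real.log (infoDet k (σ2 j) l)))) := by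
    intro m
    induction m with
    | zero => exact ⟨[], rfl, by simp, Or.inr ⟨by simp [infoDet_nil], by simp⟩⟩
    | succ m ih =>
      obtain ⟨l, hlen, hlev, hl⟩ := ih
      have hmem : ∀ x₀ : D₀, ∀ p ∈ l ++ [(x₀, j)], p.2 = j := by
        intro x₀ p hp
        rcases List.mem_append.1 hp with hp | hp
        · exact hlev p hp
        · rw [List.mem_singleton.1 hp]
      by_cases hc : ∀ z, postVar k (fun p => σ2 p.2) l z ≤ v
      · obtain ⟨x₀⟩ := ‹Nonempty D₀›
        exact ⟨l ++ [(x₀, j)], by simp [hlen], hmem x₀, Or.inl fun z =>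
          (postVar_le_of_sublist hk' hσ' (List.sublist_append_left _ _) z).trans (hc z)⟩
      · obtain ⟨hl, -⟩ := hl.resolve_left hc
        push Not at hc
        obtain ⟨z, hz⟩ := hc
        -- The lifted kernel ignores the noise level, so the point may be queried at level `j`
        -- instead of its own.
        have hz' : v < postVar k (fun p => σ2 p.2) l (z.1, j) := hz
        have hs := inv_pos.2 (hσ j)
        have h0 : 0 < 1 + (σ2 j)⁻¹ * v := by positivity
        have h1 : 1 + (σ2 j)⁻¹ * v < 1 + (σ2 j)⁻¹ * postVar k (fun p => σ2 p.2) l (z.1, j) := by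
          gcongr
        have h2 := Real.log_lt_log h0 h1
        have h3 : (((m + 1 : ℕ) : ℝ)) * Real.log (1 + (σ2 j)⁻¹ * v) <
            Real.log (infoDet k (σ2 j) (l ++ [(z.1, j)])) := by
          rw [infoDet_append_singleton (noiseVar := fun p => σ2 p.2) hk' hσ' (hσ j)
            (fun p hp => by rw [hlev p hp]) rfl, Real.log_mul (infoDet_pos hk' (hσ j) _).ne'
            (h0.trans h1).ne']
          push_cast
          linarith
        exact ⟨l ++ [(z.1, j)], by simp [hlen], hmem z.1, Or.inr ⟨h3.le, fun _ => h3⟩⟩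
  obtain ⟨l, hlen, hlev, hl⟩ := key n
  refine ⟨l, hlen, hlev, hl.resolve_right fun hl => ?_⟩
  have h1 := hl.2 hn
  have h2 := log_infoDet_le_maxInfoGain (k := k₀) Prod.fst (σ2 j) l
  rw [hlen] at h2
  exact absurd (h1.trans_le h2) (not_lt.2 h)

theorem le_log_one_add {u : ℝ} (hu : 0 ≤ u) : 2 * u / (2 + u) ≤ Real.log (1 + u) := by
  have := Real.le_log_one_add_of_nonneg hu
  rwa [add_comm u 2] at this

/-- A form of `exists_cover` with an explicit number of observations. -/
theorem exists_cover_of_le [Finite D₀] [Nonempty D₀] (hk : (Matrix.of k₀).PosSemidef)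
    (hσ : ∀ j, 0 < σ2 j) (j : Fin K) {v : ℝ} (hv : 0 < v) {n : ℕ} (hn : 1 ≤ n)
    (h : 2 * maxInfoGain k₀ (σ2 j) n * (σ2 j / v + 1 / 2) ≤ n) :
    ∃ l : List (D₀ × Fin K), l.length = n ∧ (∀ p ∈ l, p.2 = j) ∧
      ∀ z, postVar (fun p q : D₀ × Fin K => k₀ p.1 q.1) (fun p => σ2 p.2) l z ≤ v := by
  refine exists_cover hk hσ j hv.le hn ?_
  have hs := hσ j
  have h1 := le_log_one_add (u := (σ2 j)⁻¹ * v) (by positivity)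
  have h2 : 2 * ((σ2 j)⁻¹ * v) / (2 + (σ2 j)⁻¹ * v) * (σ2 j / v + 1 / 2) = 1 := by
    field_simp
  set c := 2 * ((σ2 j)⁻¹ * v) / (2 + (σ2 j)⁻¹ * v) with hc
  have hc0 : 0 < c := by positivity
  calc 2 * maxInfoGain k₀ (σ2 j) n
      = 2 * maxInfoGain k₀ (σ2 j) n * (σ2 j / v + 1 / 2) * c := by
        rw [mul_assoc, mul_comm _ c, h2, mul_one]
    _ ≤ n * c := mul_le_mul_of_nonneg_right h hc0.le
    _ ≤ _ := mul_le_mul_of_nonneg_left h1 (Nat.cast_nonneg _)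

end Cover

/-! ### Submodularity, without and with truncation -/

section Submodular

variable {D : Type*} {k : D → D → ℝ} {noiseVar : D → ℝ}

/-- Diminishing returns: each point of `S` gains at most what it would gain if it were added alone.
-/
theorem postVar_sub_le_sum (hsub : SubmodularVarReduction k noiseVar) (l : List D) (z : D)
    (S : List D) :
    postVar k noiseVar l z - postVar k noiseVar (l ++ S) z ≤
      (S.map fun p => postVar k noiseVar l z - postVar k noiseVar (l ++ [p]) z).sum := by
  induction S using List.reverseRecOn with
  | nil => simp
  | append_singleton S p ih =>
    have h := hsub l z [] S (List.nil_subperm) p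
    simp only [varReduction, List.nil_append, List.append_nil] at h
    rw [List.map_append, List.sum_append, List.map_singleton, List.sum_singleton]
    linarith

theorem postVar_nil (z : D) : postVar k noiseVar [] z = k z z := by
  have : kernelVec k [] z ⬝ᵥ (noisyGram k noiseVar [])⁻¹.mulVec (kernelVec k [] z) = 0 :=
    Finset.sum_empty
  rw [postVar, this, sub_zero]

theorem list_sum_map_finset_sum {ι : Type*} (S : List D) (M : Finset ι) (g : D → ι → ℝ) :
    (S.map fun p => ∑ z ∈ M, g p z).sum = ∑ z ∈ M, (S.map fun p => g p z).sum := by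
  induction S with
  | nil => simp
  | cons p S ih => simp [ih, Finset.sum_add_distrib]

/-- Truncation can destroy submodularity, but the sum bound survives for a collection that reaches
the target. If a single point of `S` reaches it, that term alone is the whole left side. Otherwise
truncation is inactive in every term, and the untruncated bound applies, unless the target was met
at the outset and the left side is zero. -/
theorem truncated_sub_le_sum (hk : (Matrix.of k).PosSemidef) (hn : ∀ x, 0 < noiseVar x)
    (hsub : SubmodularVarReduction k noiseVar) {b e : ℝ} (hb : 0 ≤ b) (l : List D) (z : D)
    {S : List D} (hS : b * postVar k noiseVar (l ++ S) z ≤ e) :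
    max (b * postVar k noiseVar l z) e - e ≤
      (S.map fun p => max (b * postVar k noiseVar l z) e -
        max (b * postVar k noiseVar (l ++ [p]) z) e).sum := by
  have hmono : ∀ p, b * postVar k noiseVar (l ++ [p]) z ≤ b * postVar k noiseVar l z := fun p =>
    mul_le_mul_of_nonneg_left (postVar_le_of_sublist hk hn (List.sublist_append_left _ _) z) hb
  have hnonneg : ∀ p, 0 ≤ max (b * postVar k noiseVar l z) e -
      max (b * postVar k noiseVar (l ++ [p]) z) e := fun p =>
    sub_nonneg.2 (max_le_max_right _ (hmono p))
  by_cases hex : ∃ p ∈ S, b * postVar k noiseVar (l ++ [p]) z ≤ e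
  · obtain ⟨p, hp, hpe⟩ := hex
    have h1 := List.single_le_sum (l := S.map fun p => max (b * postVar k noiseVar l z) e -
        max (b * postVar k noiseVar (l ++ [p]) z) e) (by
      intro y hy
      obtain ⟨q, -, rfl⟩ := List.mem_map.1 hy
      exact hnonneg q) _ (List.mem_map_of_mem hp)
    rwa [max_eq_right hpe] at h1
  · push Not at hex
    rcases le_total (b * postVar k noiseVar l z) e with hle | hle
    · rw [max_eq_right hle, sub_self]
      refine List.sum_nonneg fun y hy => ?_
      obtain ⟨q, -, rfl⟩ := List.mem_map.1 hy
      have := hnonneg q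
      rwa [max_eq_right hle] at this
    · have h1 := mul_le_mul_of_nonneg_left (postVar_sub_le_sum hsub l z S) hb
      rw [← List.sum_map_mul_left] at h1
      have h2 : (S.map fun p => max (b * postVar k noiseVar l z) e -
          max (b * postVar k noiseVar (l ++ [p]) z) e) =
          S.map fun p => b * (postVar k noiseVar l z - postVar k noiseVar (l ++ [p]) z) := by
        refine List.map_congr_left fun p hp => ?_
        rw [max_eq_left hle, max_eq_left (hex p hp).le, mul_sub]
      rw [h2, max_eq_left hle]
      linarith

end Submodular

/-! ### The potential and one greedy step -/

namespace Input

variable {D : Type*} (A : Input D)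

/-- Sum of the excesses of the scaled posterior variances over the squared target. -/
noncomputable def potential (i : ℕ) (M : Finset D) (l : List D) : ℝ :=
  ∑ z ∈ M, (max (A.β i * postVar A.kernel A.noiseVar l z) (A.η i ^ 2) - A.η i ^ 2)

theorem potential_mono {i : ℕ} {M M' : Finset D} (h : M ⊆ M') (l : List D) :
    A.potential i M l ≤ A.potential i M' l :=
  Finset.sum_le_sum_of_subset_of_nonneg h fun _ _ _ => sub_nonneg.2 (le_max_right _ _)

theorem potential_nonneg (i : ℕ) (M : Finset D) (l : List D) : 0 ≤ A.potential i M l :=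
  Finset.sum_nonneg fun _ _ => sub_nonneg.2 (le_max_right _ _)

theorem acquisition_mul_cost (hc : ∀ x, 0 < A.cost x) (i : ℕ) (M : Finset D) (l : List D) (x : D) :
    A.acquisition i M l x * A.cost x =
      ∑ z ∈ M, (max (A.β i * postVar A.kernel A.noiseVar l z) (A.η i ^ 2) -
        max (A.β i * postVar A.kernel A.noiseVar (l ++ [x]) z) (A.η i ^ 2)) := by
  rw [acquisition, div_mul_cancel₀ _ (hc x).ne', Finset.sum_sub_distrib]

theorem acquisition_mul_cost_eq_sub (hc : ∀ x, 0 < A.cost x) (i : ℕ) (M : Finset D) (l : List D)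
    (x : D) :
    A.acquisition i M l x * A.cost x = A.potential i M l - A.potential i M (l ++ [x]) := by
  rw [acquisition_mul_cost A hc, potential, potential, ← Finset.sum_sub_distrib]
  exact Finset.sum_congr rfl fun z _ => by ring

/-- The hypothesis on `S` concerns the prior only: by monotonicity of the variance, `S` still
reaches the target after any past `l`. The gains of its points sum to at least the potential, and
none has a better gain per cost than `x`. -/
theorem potential_le_acquisition_mul (hk : (Matrix.of A.kernel).PosSemidef)
    (hn : ∀ x, 0 < A.noiseVar x) (hc : ∀ x, 0 < A.cost x)
    (hsub : SubmodularVarReduction A.kernel A.noiseVar) {i : ℕ} (hβ : 0 ≤ A.β i) {M : Finset D}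
    {l : List D} {x : D} (hx : ∀ x', A.acquisition i M l x' ≤ A.acquisition i M l x)
    {S : List D} (hS : ∀ z, A.β i * postVar A.kernel A.noiseVar S z ≤ A.η i ^ 2) :
    A.potential i M l ≤ A.acquisition i M l x * (S.map A.cost).sum := by
  have h1 : A.potential i M l ≤ (S.map fun p => A.acquisition i M l p * A.cost p).sum := by
    simp only [acquisition_mul_cost A hc]
    rw [potential, list_sum_map_finset_sum]
    refine Finset.sum_le_sum fun z _ => ?_
    refine truncated_sub_le_sum hk hn hsub hβ l z ((mul_le_mul_of_nonneg_left
      (postVar_le_of_sublist hk hn (List.sublist_append_right _ _) z) hβ).trans (hS z))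
  refine h1.trans ?_
  rw [← List.sum_map_mul_left]
  exact List.sum_le_sum fun p _ => mul_le_mul_of_nonneg_right (hx p) (hc p).le

section Greedy

variable {A} (hk : (Matrix.of A.kernel).PosSemidef) (hn : ∀ x, 0 < A.noiseVar x)
  (hc : ∀ x, 0 < A.cost x) (hsub : SubmodularVarReduction A.kernel A.noiseVar)
  {i : ℕ} (hβ : 0 ≤ A.β i) {M : Finset D} {l : List D} {x : D}
  (hx : ∀ x', A.acquisition i M l x' ≤ A.acquisition i M l x) {C : ℝ} (hC : 0 < C)
  (hS : ∃ S : List D, (S.map A.cost).sum = C ∧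
    ∀ z, A.β i * postVar A.kernel A.noiseVar S z ≤ A.η i ^ 2)
include hk hn hc hsub hβ hx hC hS

/-- The query removes at least the fraction `cost x / C` of the potential, and `1 - u ≤ exp (-u)`.
-/
theorem potential_append_le :
    A.potential i M (l ++ [x]) ≤ A.potential i M l * Real.exp (-(A.cost x / C)) := by
  obtain ⟨S, rfl, hS⟩ := hS
  have h1 := potential_le_acquisition_mul A hk hn hc hsub hβ hx hS
  have h2 := acquisition_mul_cost_eq_sub A hc i M l x
  set C := (S.map A.cost).sum
  have h3 : A.potential i M l * (A.cost x / C) ≤ A.acquisition i M l x * A.cost x := by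
    calc A.potential i M l * (A.cost x / C)
        ≤ A.acquisition i M l x * C * (A.cost x / C) :=
          mul_le_mul_of_nonneg_right h1 (div_pos (hc x) hC).le
      _ = _ := by field_simp
  have h4 : A.potential i M l * (1 - A.cost x / C) ≤
      A.potential i M l * Real.exp (-(A.cost x / C)) :=
    mul_le_mul_of_nonneg_left (by linarith [Real.add_one_le_exp (-(A.cost x / C))])
      (potential_nonneg A i M l)
  linarith

/-- A query cannot remove more than the whole potential, yet it removes at least the fraction `cost
x / C`. This bounds the overshoot of the last query of an epoch. -/
theorem cost_le_of_potential_pos (hpos : 0 < A.potential i M l) : A.cost x ≤ C := by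
  obtain ⟨S, rfl, hS⟩ := hS
  have h1 := potential_le_acquisition_mul A hk hn hc hsub hβ hx hS
  have h2 := acquisition_mul_cost_eq_sub A hc i M l x
  set C := (S.map A.cost).sum
  have h3 := potential_nonneg A i M (l ++ [x])
  have h4 : 0 < A.acquisition i M l x := by
    by_contra h
    have := mul_nonpos_of_nonpos_of_nonneg (not_lt.1 h) hC.le
    linarith
  exact le_of_mul_le_mul_left (by linarith) h4

end Greedy

/-- One point that fails the test contributes more than `(1 + δbar)² η² - η²`. -/
theorem lt_potential_of_not_epochDone (hk : (Matrix.of A.kernel).PosSemidef)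
    (hn : ∀ x, 0 < A.noiseVar x) (h1 : ∀ x, A.kernel x x = 1) (hd : 0 < A.δbar)
    {i : ℕ} (hβ : 0 < A.β i) (hη : 0 < A.η i) {M : Finset D}
    {l : List D} (h : ¬ A.EpochDone i M l) :
    (2 * A.δbar + A.δbar ^ 2) * A.η i ^ 2 < A.potential i M l := by
  unfold EpochDone at h
  push Not at h
  obtain ⟨z, hz, hlt⟩ := h
  have hv := postVar_pos hk hn l z (by rw [h1]; exact one_pos)
  have hsq : ((1 + A.δbar) * A.η i) ^ 2 < A.β i * postVar A.kernel A.noiseVar l z := by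
    have := pow_lt_pow_left₀ hlt (by positivity) two_ne_zero
    rwa [postStd, mul_pow √(A.β i), Real.sq_sqrt hβ.le, Real.sq_sqrt hv.le] at this
  have h2 : max (A.β i * postVar A.kernel A.noiseVar l z) (A.η i ^ 2) - A.η i ^ 2 ≤
      A.potential i M l :=
    Finset.single_le_sum (f := fun z => max (A.β i * postVar A.kernel A.noiseVar l z)
      (A.η i ^ 2) - A.η i ^ 2) (fun _ _ => sub_nonneg.2 (le_max_right _ _)) hz
  have h3 := le_max_left (A.β i * postVar A.kernel A.noiseVar l z) (A.η i ^ 2)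
  nlinarith

section Run

variable [Fintype D]

theorem state_succ_M_subset (x : ℕ → D) (y : ℕ → ℝ) (t : ℕ) :
    (A.state x y (t + 1)).M ⊆ (A.state x y t).M := by
  simp only [state, update]
  cases A.task <;> exact Finset.filter_subset _ _

theorem state_succ_epoch (x : ℕ → D) (y : ℕ → ℝ) (t : ℕ) :
    (A.state x y (t + 1)).epoch =
      A.nextEpoch (A.state x y t).epoch (A.state x y (t + 1)).M (history x (t + 1)) := by
  simp only [state, update]
  cases A.task <;> rfl

end Run

theorem history_succ (x : ℕ → D) (t : ℕ) : history x (t + 1) = history x t ++ [x t] := by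
  simp [history, List.range_succ]

theorem le_nextEpoch (i : ℕ) (M : Finset D) (l : List D) : i ≤ A.nextEpoch i M l := by
  classical
  unfold nextEpoch
  split_ifs with h
  · exact (Nat.find_spec h).1
  · exact le_rfl

theorem epochDone_of_lt_nextEpoch {i j : ℕ} {M : Finset D} {l : List D} (hij : i ≤ j)
    (hj : j < A.nextEpoch i M l) : A.EpochDone j M l := by
  classical
  unfold nextEpoch at hj
  split_ifs at hj with h
  · by_contra hn
    exact Nat.find_min h hj ⟨hij, hn⟩
  · exact absurd hij (not_le.2 hj)

/-- While points remain, the epoch reached has not met its target. -/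
theorem not_epochDone_nextEpoch (hk : (Matrix.of A.kernel).PosSemidef)
    (hn : ∀ x, 0 < A.noiseVar x) (h1 : ∀ x, A.kernel x x = 1) (hr0 : 0 ≤ A.r) (hr : A.r < 1)
    {b : ℝ} (hb : 0 < b) (hβ : ∀ i, b ≤ A.β i) (i : ℕ) {M : Finset D} (hM : M.Nonempty)
    (l : List D) : ¬ A.EpochDone (A.nextEpoch i M l) M l := by
  classical
  have hex : ∃ j, i ≤ j ∧ ¬ A.EpochDone j M l := by
    obtain ⟨z, hz⟩ := hM
    have hv := Real.sqrt_pos.2 (postVar_pos hk hn l z (by rw [h1]; exact one_pos))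
    have hlim : Filter.Tendsto (fun j => (1 + A.δbar) * A.η j) Filter.atTop (nhds 0) := by
      have := ((tendsto_pow_atTop_nhds_zero_of_lt_one hr0 hr).const_mul A.η₁).const_mul
        (1 + A.δbar)
      simpa [η] using this
    obtain ⟨j, hj, hij⟩ := ((hlim.eventually_lt_const
      (mul_pos (Real.sqrt_pos.2 hb) hv)).and (Filter.eventually_ge_atTop i)).exists
    refine ⟨j, hij, fun hdone => ?_⟩
    have h2 : √b * √(postVar A.kernel A.noiseVar l z) ≤
        √(A.β j) * postStd A.kernel A.noiseVar l z :=
      mul_le_mul_of_nonneg_right (Real.sqrt_le_sqrt (hβ j)) hv.le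
    linarith [hdone z hz]
  rw [nextEpoch, dif_pos hex]
  exact (Nat.find_spec hex).2

end Input

/-! ### Budgets of the epochs and the bound on the cumulative cost -/

/-- Per-epoch budgets that suffice for the greedy rule to finish every epoch: `C i` is the cost of
a collection of points that meets the target of epoch `i`, `B i` bounds the potential at the
start of epoch `i`, and `V i` is the total budget of the epochs before `i`. -/
structure EpochBudget {D : Type*} [Fintype D] (A : Input D) (C F B V : ℕ → ℝ) : Prop where
  cost_pos : ∀ i, 0 < C i
  cover : ∀ i, ∃ S : List D, (S.map A.cost).sum = C i ∧
    ∀ z, A.β i * postVar A.kernel A.noiseVar S z ≤ A.η i ^ 2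
  one_le : ∀ i, 1 ≤ F i
  factor : ∀ i, Real.exp 1 * B i ≤ (2 * A.δbar + A.δbar ^ 2) * A.η i ^ 2 * Real.exp (F i)
  initial : A.potential 0 Finset.univ [] ≤ B 0
  initial_succ : ∀ i M l, A.EpochDone i M l → A.potential (i + 1) M l ≤ B (i + 1)
  total_zero : V 0 = 0
  total_succ : ∀ i, V (i + 1) = V i + C i * F i

namespace EpochBudget

variable {D : Type*} [Fintype D] {A : Input D} {C F B V : ℕ → ℝ}

theorem monotone_total (hE : EpochBudget A C F B V) : Monotone V := by
  refine monotone_nat_of_le_succ fun i => ?_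
  rw [hE.total_succ]
  have := mul_pos (hE.cost_pos i) (one_pos.trans_le (hE.one_le i))
  linarith

/-- The cumulative cost is within the budget until no points remain. -/
theorem cumCost_le [Nonempty D] (hE : EpochBudget A C F B V)
    (hk : (Matrix.of A.kernel).PosSemidef) (hn : ∀ x, 0 < A.noiseVar x)
    (h1 : ∀ x, A.kernel x x = 1) (hc : ∀ x, 0 < A.cost x)
    (hsub : SubmodularVarReduction A.kernel A.noiseVar) (hd : 0 < A.δbar)
    (hr0 : 0 < A.r) (hr : A.r < 1) (hη1 : 0 < A.η₁) {b : ℝ} (hb : 0 < b) (hβ : ∀ i, b ≤ A.β i)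
    (hβ0 : A.η₁ ^ 2 < A.β 0) {x : ℕ → D} {y : ℕ → ℝ} (hg : A.GreedySelection x y) (t : ℕ)
    (hM : (A.state x y t).M.Nonempty) :
    cumCost A.cost x (t + 1) ≤ V ((A.state x y t).epoch + 1) := by
  have hη : ∀ i, 0 < A.η i := fun i => mul_pos hη1 (pow_pos hr0 i)
  have hβp : ∀ i, 0 < A.β i := fun i => hb.trans_le (hβ i)
  have hcum : ∀ t, cumCost A.cost x (t + 1) = cumCost A.cost x t + A.cost (x t) := fun t =>
    Finset.sum_range_succ _ _
  have hstep : ∀ t, ((A.state x y t).M.Nonempty →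
      A.potential (A.state x y t).epoch (A.state x y t).M (history x t) ≤
        B (A.state x y t).epoch * Real.exp (-((cumCost A.cost x t -
          V (A.state x y t).epoch) / C (A.state x y t).epoch)) ∧
      (t = 0 ∨ ¬ A.EpochDone (A.state x y t).epoch (A.state x y t).M (history x t))) →
      (A.state x y t).M.Nonempty →
      cumCost A.cost x (t + 1) ≤ V ((A.state x y t).epoch + 1) := by
    intro t hinv hM
    obtain ⟨hpot, hdone⟩ := hinv hM
    rw [hE.total_succ, hcum]
    set i := (A.state x y t).epoch with hi
    have hCi := hE.cost_pos i
    -- No test precedes the very first query, so at time `0` the failure of the test is not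
    -- available. There the potential is positive because the initial parameter exceeds the squared
    -- first target, which bounds the cost of one query.
    rcases hdone with rfl | hdone
    · have hi0 : i = 0 := rfl
      have hpos : 0 < A.potential i (A.state x y 0).M (history x 0) := by
        have hM0 : (A.state x y 0).M = Finset.univ := rfl
        rw [hi0, hM0]
        refine Finset.sum_pos (fun z _ => ?_) Finset.univ_nonempty
        have : A.η 0 ^ 2 < A.β 0 * postVar A.kernel A.noiseVar (history x 0) z := by
          have h2 : history x 0 = [] := rfl
          rw [h2, postVar_nil, h1, mul_one, Input.η, pow_zero, mul_one]
          exact hβ0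
        exact sub_pos.2 (lt_max_of_lt_left this)
      have := Input.cost_le_of_potential_pos hk hn hc hsub (hβp i).le (hg 0) hCi (hE.cover i) hpos
      have h2 : C i ≤ C i * F i := le_mul_of_one_le_right hCi.le (hE.one_le i)
      have h3 : cumCost A.cost x 0 = 0 := rfl
      have h4 : V i = 0 := hE.total_zero
      linarith
    · have hlt := A.lt_potential_of_not_epochDone hk hn h1 hd (hβp i) (hη i) hdone
      have hθ : 0 < (2 * A.δbar + A.δbar ^ 2) * A.η i ^ 2 :=
        mul_pos (by positivity) (pow_pos (hη i) 2)
      have hcost := Input.cost_le_of_potential_pos hk hn hc hsub (hβp i).le (hg t) hCi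
        (hE.cover i) (hθ.trans hlt)
      set u := (cumCost A.cost x t - V i) / C i with hu
      -- Since the potential is still above the threshold, the cost spent in the epoch is below `C i
      -- * (F i - 1)`. The factor `exp 1` in the budget reserves the remaining `C i` for the next
      -- query.
      have h2 : Real.exp 1 * ((2 * A.δbar + A.δbar ^ 2) * A.η i ^ 2) <
          (2 * A.δbar + A.δbar ^ 2) * A.η i ^ 2 * Real.exp (F i) * Real.exp (-u) := by
        calc _ < Real.exp 1 * (B i * Real.exp (-u)) :=
              mul_lt_mul_of_pos_left (hlt.trans_le hpot) (Real.exp_pos 1)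
          _ = Real.exp 1 * B i * Real.exp (-u) := by ring
          _ ≤ _ := mul_le_mul_of_nonneg_right (hE.factor i) (Real.exp_pos _).le
      rw [mul_assoc _ (Real.exp (F i)), ← Real.exp_add, mul_comm (Real.exp 1)] at h2
      have h3 := Real.exp_lt_exp.1 (lt_of_mul_lt_mul_left h2 hθ.le)
      have h4 : cumCost A.cost x t - V i = u * C i := by rw [hu]; field_simp
      nlinarith
  refine hstep t ?_ hM
  clear hM
  induction t with
  | zero =>
    intro _
    refine ⟨?_, Or.inl rfl⟩
    have h2 : cumCost A.cost x 0 = 0 := rfl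
    have h3 : (A.state x y 0).epoch = 0 := rfl
    rw [h2, h3, hE.total_zero, sub_zero, zero_div, neg_zero, Real.exp_zero, mul_one]
    exact hE.initial
  | succ t ih =>
    intro hM
    have hsubset := A.state_succ_M_subset x y t
    have hMt : (A.state x y t).M.Nonempty := hM.mono hsubset
    have hbud := hstep t ih hMt
    obtain ⟨hpot, -⟩ := ih hMt
    have hep := A.state_succ_epoch x y t
    have hnd := A.not_epochDone_nextEpoch hk hn h1 hr0.le hr hb hβ (A.state x y t).epoch hM
      (history x (t + 1))
    rw [← hep] at hnd
    refine ⟨?_, Or.inr hnd⟩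
    have hle := A.le_nextEpoch (A.state x y t).epoch (A.state x y (t + 1)).M (history x (t + 1))
    rw [← hep] at hle
    rcases hle.eq_or_lt with heq | hlt
    · rw [← heq]
      set i := (A.state x y t).epoch
      have h2 := Input.potential_append_le hk hn hc hsub (hβp i).le (hg t) (hE.cost_pos i)
        (hE.cover i)
      refine (A.potential_mono hsubset _).trans ?_
      rw [Input.history_succ]
      refine h2.trans ((mul_le_mul_of_nonneg_right hpot (Real.exp_pos _).le).trans_eq ?_)
      rw [mul_assoc, ← Real.exp_add, hcum]
      congr 2
      ring
    -- When a new epoch begins, possibly after skipping some, the cost so far is within the budget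
    -- of the earlier epochs. The exponent in the invariant is then nonnegative and the initial
    -- bound on the potential suffices.
    · obtain ⟨j, hj⟩ := Nat.exists_eq_add_one_of_ne_zero (Nat.ne_zero_of_lt hlt)
      rw [hj] at hlt ⊢
      have hdone : A.EpochDone j (A.state x y (t + 1)).M (history x (t + 1)) :=
        A.epochDone_of_lt_nextEpoch (Nat.lt_succ_iff.1 hlt) (by rw [← hep, hj]; exact j.lt_succ_self)
      have h2 := hE.initial_succ _ _ _ hdone
      have h3 : cumCost A.cost x (t + 1) - V (j + 1) ≤ 0 :=
        sub_nonpos.2 (hbud.trans (hE.monotone_total hlt))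
      have h4 : 0 ≤ -((cumCost A.cost x (t + 1) - V (j + 1)) / C (j + 1)) :=
        neg_nonneg.2 (div_nonpos_of_nonpos_of_nonneg h3 (hE.cost_pos _).le)
      have h5 : 0 ≤ B (j + 1) := (A.potential_nonneg _ _ _).trans h2
      exact h2.trans (le_mul_of_one_le_right h5 (Real.one_le_exp h4))

end EpochBudget

/-! ### From valid confidence bounds to accuracy -/

namespace Input

variable {D : Type*} [Fintype D] (A : Input D)

/-- The confidence bounds are valid at all times up to which points remain. -/
def ConfidenceValid (f : D → ℝ) (x : ℕ → D) (y : ℕ → ℝ) : Prop :=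
  ∀ t, (A.state x y t).M.Nonempty → ∀ z,
    |f z - postMean A.kernel A.noiseVar (history x (t + 1)) y z| ≤
      √(A.β (A.state x y t).epoch) * postStd A.kernel A.noiseVar (history x (t + 1)) z

variable {A} {f : D → ℝ} {x : ℕ → D} {y : ℕ → ℝ}

theorem ConfidenceValid.lcb_le (h : A.ConfidenceValid f x y) {t : ℕ}
    (hM : (A.state x y t).M.Nonempty) (z : D) :
    A.lcb (A.state x y t).epoch (history x (t + 1)) y z ≤ f z := by
  have := (abs_le.1 (h t hM z)).1
  rw [lcb]; linarith

theorem ConfidenceValid.le_ucb (h : A.ConfidenceValid f x y) {t : ℕ}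
    (hM : (A.state x y t).M.Nonempty) (z : D) :
    f z ≤ A.ucb (A.state x y t).epoch (history x (t + 1)) y z := by
  have := (abs_le.1 (h t hM z)).2
  rw [ucb]; linarith

/-- At the step that leaves epoch `m`, the test of epoch `m` was passed, with half-width at most `ε
/ 4`. That test uses `β m`, whereas the intervals use the current epoch's parameter, which is why
the parameters up to `m` must agree. -/
theorem ucb_sub_lcb_le {m : ℕ} (hm : ∀ i ≤ m, A.β i = A.β m) {ε : ℝ}
    (hε : 4 * ((1 + A.δbar) * A.η m) ≤ ε) {t : ℕ} (hlt : (A.state x y t).epoch ≤ m)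
    (hgt : m < (A.state x y (t + 1)).epoch) {z : D} (hz : z ∈ (A.state x y (t + 1)).M) :
    A.ucb (A.state x y t).epoch (history x (t + 1)) y z -
      A.lcb (A.state x y t).epoch (history x (t + 1)) y z ≤ ε / 2 := by
  rw [A.state_succ_epoch] at hgt
  have := A.epochDone_of_lt_nextEpoch hlt hgt z hz
  rw [← hm _ hlt] at this
  rw [ucb, lcb]
  linarith

/-- A maximizer always passes the filter. At the step that leaves epoch `m`, a surviving point has
its upper bound above the maximizer's lower bound, so the two interval widths of `ε / 2` add up to
`ε`. Later sets only shrink. -/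
theorem epsAccurate_bo [Nonempty D] (hA : A.task = Task.bo) (h : A.ConfidenceValid f x y) {m : ℕ}
    (hm : ∀ i ≤ m, A.β i = A.β m) {ε : ℝ} (hε : 4 * ((1 + A.δbar) * A.η m) ≤ ε) (t : ℕ)
    (ht : (A.state x y t).M.Nonempty → m < (A.state x y t).epoch) :
    EpsAccurate f ε (A.state x y t) Task.bo := by
  have hstate : ∀ t z, z ∈ (A.state x y (t + 1)).M ↔ z ∈ (A.state x y t).M ∧
      ∀ z' ∈ (A.state x y t).M, A.lcb (A.state x y t).epoch (history x (t + 1)) y z' ≤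
        A.ucb (A.state x y t).epoch (history x (t + 1)) y z := by
    intro t z
    simp only [state, update, hA, Finset.mem_filter]
  have key : ∀ t, (∀ z, (∀ w, f w ≤ f z) → z ∈ (A.state x y t).M) ∧
      (m < (A.state x y t).epoch → ∀ z ∈ (A.state x y t).M, ∀ z', (∀ w, f w ≤ f z') →
        f z' - f z ≤ ε) := by
    intro t
    induction t with
    | zero => exact ⟨fun z _ => Finset.mem_univ z, fun h => absurd h (Nat.not_lt_zero m)⟩
    | succ t ih =>
      obtain ⟨ih1, ih2⟩ := ih
      have hmem : ∀ z, (∀ w, f w ≤ f z) → z ∈ (A.state x y (t + 1)).M := fun z hz => by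
        have hzM := ih1 z hz
        exact (hstate t z).2 ⟨hzM, fun z' _ =>
          ((h.lcb_le ⟨z, hzM⟩ z').trans (hz z')).trans (h.le_ucb ⟨z, hzM⟩ z)⟩
      refine ⟨hmem, fun hgt z hz z' hz' => ?_⟩
      have hzM := A.state_succ_M_subset x y t hz
      rcases lt_or_ge m (A.state x y t).epoch with hlt | hle
      · exact ih2 hlt z hzM z' hz'
      · have h1 := ucb_sub_lcb_le hm hε hle hgt hz
        have h2 := ucb_sub_lcb_le hm hε hle hgt (hmem z' hz')
        have h3 := ((hstate t z).1 hz).2 z' (ih1 z' hz')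
        have h4 := h.lcb_le ⟨z, hzM⟩ z
        have h5 := h.le_ucb ⟨z, hzM⟩ z'
        linarith
  obtain ⟨z, hz⟩ := Finite.exists_max f
  exact ⟨(key t).1, (key t).2 (ht ⟨z, (key t).1 z hz⟩)⟩

/-- At the step that leaves epoch `m`, the threshold and the reward lie in the same interval of
width at most `ε / 2` for every unclassified point. -/
theorem epsAccurate_lse {θ : ℝ} (hA : A.task = Task.lse θ) (h : A.ConfidenceValid f x y) {m : ℕ}
    (hm : ∀ i ≤ m, A.β i = A.β m) {ε : ℝ} (hε : 4 * ((1 + A.δbar) * A.η m) ≤ ε) (t : ℕ)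
    (ht : (A.state x y t).M.Nonempty → m < (A.state x y t).epoch) :
    EpsAccurate f ε (A.state x y t) (Task.lse θ) := by
  have hstate : ∀ t z, z ∈ (A.state x y (t + 1)).M ↔ z ∈ (A.state x y t).M ∧
      θ ≤ A.ucb (A.state x y t).epoch (history x (t + 1)) y z ∧
      A.lcb (A.state x y t).epoch (history x (t + 1)) y z ≤ θ := by
    intro t z
    simp only [state, update, hA, Finset.mem_filter]
  have hH : ∀ t z, z ∈ (A.state x y (t + 1)).H ↔ z ∈ (A.state x y t).H ∨
      z ∈ (A.state x y t).M ∧ θ < A.lcb (A.state x y t).epoch (history x (t + 1)) y z := by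
    intro t z
    simp only [state, update, hA, Finset.mem_filter, Finset.mem_union]
  have hL : ∀ t z, z ∈ (A.state x y (t + 1)).L ↔ z ∈ (A.state x y t).L ∨
      z ∈ (A.state x y t).M ∧ A.ucb (A.state x y t).epoch (history x (t + 1)) y z < θ := by
    intro t z
    simp only [state, update, hA, Finset.mem_filter, Finset.mem_union]
  have key : ∀ t, (∀ z ∈ (A.state x y t).H, θ < f z) ∧ (∀ z ∈ (A.state x y t).L, f z < θ) ∧
      (m < (A.state x y t).epoch → ∀ z ∈ (A.state x y t).M, |f z - θ| ≤ ε / 2) := by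
    intro t
    induction t with
    | zero =>
      exact ⟨fun z hz => absurd hz (Finset.notMem_empty z),
        fun z hz => absurd hz (Finset.notMem_empty z), fun h => absurd h (Nat.not_lt_zero m)⟩
    | succ t ih =>
      obtain ⟨ih1, ih2, ih3⟩ := ih
      refine ⟨fun z hz => ?_, fun z hz => ?_, fun hgt z hz => ?_⟩
      · rcases (hH t z).1 hz with hz | ⟨hzM, hz⟩
        · exact ih1 z hz
        · exact hz.trans_le (h.lcb_le ⟨z, hzM⟩ z)
      · rcases (hL t z).1 hz with hz | ⟨hzM, hz⟩
        · exact ih2 z hz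
        · exact (h.le_ucb ⟨z, hzM⟩ z).trans_lt hz
      · obtain ⟨hzM, hu, hl⟩ := (hstate t z).1 hz
        rcases lt_or_ge m (A.state x y t).epoch with hlt | hle
        · exact ih3 hlt z hzM
        · have h1 := ucb_sub_lcb_le hm hε hle hgt hz
          have h4 := h.lcb_le ⟨z, hzM⟩ z
          have h5 := h.le_ucb ⟨z, hzM⟩ z
          rw [abs_le]
          constructor <;> linarith
  refine ⟨(key t).1, (key t).2.1, fun z hz => (key t).2.2 (ht ⟨z, hz⟩) z hz⟩

/-- With valid confidence bounds, the state is accurate as soon as no points remain or an epoch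
with a small enough target is over. -/
theorem epsAccurate [Nonempty D] (h : A.ConfidenceValid f x y) {m : ℕ}
    (hm : ∀ i ≤ m, A.β i = A.β m) {ε : ℝ} (hε : 4 * ((1 + A.δbar) * A.η m) ≤ ε) (t : ℕ)
    (ht : (A.state x y t).M.Nonempty → m < (A.state x y t).epoch) :
    EpsAccurate f ε (A.state x y t) A.task := by
  rcases hA : A.task with _ | θ
  · exact epsAccurate_bo hA h hm hε t ht
  · exact epsAccurate_lse hA h hm hε t ht

end Input

/-! ### A Gaussian tail bound -/

section GaussianTail

open scoped NNReal ENNReal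

/-- For nonnegative `c` and `u` one has `(u + c)² ≥ u² + c²`. -/
theorem gaussianPDFReal_neg_mean_le {v : ℝ≥0} {c u : ℝ} (hc : 0 ≤ c) (hu : 0 ≤ u) :
    gaussianPDFReal (-c) v u ≤ Real.exp (-(c ^ 2 / (2 * v))) * gaussianPDFReal 0 v u := by
  rw [gaussianPDFReal, gaussianPDFReal, mul_left_comm, ← Real.exp_add]
  refine mul_le_mul_of_nonneg_left (Real.exp_le_exp.2 ?_) (by positivity)
  rw [neg_div, neg_div, ← neg_add, ← add_div]
  refine neg_le_neg (div_le_div_of_nonneg_right ?_ (by positivity))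
  nlinarith [mul_nonneg hc hu]

theorem gaussianReal_Ioi_le {v : ℝ≥0} (hv : v ≠ 0) {c : ℝ} (hc : 0 ≤ c) :
    gaussianReal 0 v (Set.Ioi c) ≤
      ENNReal.ofReal (Real.exp (-(c ^ 2 / (2 * v)))) * gaussianReal 0 v (Set.Ioi 0) := by
  have h1 : gaussianReal 0 v (Set.Ioi c) = gaussianReal (-c) v (Set.Ioi 0) := by
    rw [← zero_sub, ← gaussianReal_map_sub_const c, Measure.map_apply (by fun_prop)
      measurableSet_Ioi]
    congr 1
    ext u
    simp
  rw [h1, gaussianReal_apply _ hv, gaussianReal_apply _ hv,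
    ← lintegral_const_mul _ (measurable_gaussianPDF _ _)]
  refine setLIntegral_mono' measurableSet_Ioi fun u hu => ?_
  rw [gaussianPDF, gaussianPDF, ← ENNReal.ofReal_mul (Real.exp_pos _).le]
  exact ENNReal.ofReal_le_ofReal (gaussianPDFReal_neg_mean_le hc (le_of_lt hu))

/-- Two-sided Gaussian tail bound. -/
theorem gaussianReal_abs_gt_le {v : ℝ≥0} (hv : v ≠ 0) {c : ℝ} (hc : 0 ≤ c) :
    gaussianReal 0 v {u | c < |u|} ≤ ENNReal.ofReal (Real.exp (-(c ^ 2 / (2 * v)))) := by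
  have hneg : ∀ a : ℝ, gaussianReal 0 v (Set.Iio (-a)) = gaussianReal 0 v (Set.Ioi a) := by
    intro a
    have h : (gaussianReal 0 v).map (fun x => -x) = gaussianReal 0 v := by
      rw [gaussianReal_map_neg, neg_zero]
    conv_rhs => rw [← h, Measure.map_apply (by fun_prop) measurableSet_Ioi]
    congr 1
    ext u
    simp only [Set.mem_Iio, Set.mem_preimage, Set.mem_Ioi]
    exact lt_neg
  have hset : {u : ℝ | c < |u|} = Set.Ioi c ∪ Set.Iio (-c) := by
    ext u
    simp only [Set.mem_ofPred_eq, Set.mem_union, Set.mem_Ioi, Set.mem_Iio, lt_abs]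
    exact or_congr Iff.rfl lt_neg
  set e := ENNReal.ofReal (Real.exp (-(c ^ 2 / (2 * v))))
  -- The masses of the two open half-lines add up to at most `1`, so the two-sided bound has no
  -- factor `2`, as the constant in `betaT` requires.
  calc gaussianReal 0 v {u | c < |u|}
      ≤ gaussianReal 0 v (Set.Ioi c) + gaussianReal 0 v (Set.Iio (-c)) := by
        rw [hset]; exact measure_union_le _ _
    _ ≤ e * gaussianReal 0 v (Set.Ioi 0) + e * gaussianReal 0 v (Set.Iio 0) := by
        have h0 := hneg 0
        rw [neg_zero] at h0
        rw [hneg, h0]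
        exact add_le_add (gaussianReal_Ioi_le hv hc) (gaussianReal_Ioi_le hv hc)
    _ = e * gaussianReal 0 v (Set.Ioi 0 ∪ Set.Iio 0) := by
        rw [← mul_add, measure_union _ measurableSet_Iio]
        rw [Set.disjoint_left]
        intro u h1 h2
        exact lt_asymm (Set.mem_Ioi.1 h1) h2
    _ ≤ e * 1 := by gcongr; exact prob_le_one
    _ = e := mul_one e

end GaussianTail

/-! ### The prediction error for a fixed list of queries -/

section Posterior

variable {D : Type*} {Ω : Type*} [MeasurableSpace Ω] {P : Measure Ω}
  {k : D → D → ℝ} {noiseVar : D → ℝ} {f : D → Ω → ℝ} {w : ℕ → Ω → ℝ}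

/-- The observation that querying the `i`-th point of the fixed list `l` would give. -/
noncomputable def observation (noiseVar : D → ℝ) (f : D → Ω → ℝ) (w : ℕ → Ω → ℝ) (l : List D)
    (i : Fin l.length) (ω : Ω) : ℝ :=
  f (l.get i) ω + √(noiseVar (l.get i)) * w i ω

/-- The prediction error at `z` after querying the fixed list `l`. -/
noncomputable def predError (k : D → D → ℝ) (noiseVar : D → ℝ) (f : D → Ω → ℝ) (w : ℕ → Ω → ℝ)
    (l : List D) (z : D) (ω : Ω) : ℝ :=
  f z ω - ∑ i, predWeights k noiseVar l z i * observation noiseVar f w l i ω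

theorem postMean_eq_sum (hk : (Matrix.of k).PosSemidef) (hn : ∀ x, 0 < noiseVar x) (l : List D)
    (y : ℕ → ℝ) (z : D) :
    postMean k noiseVar l y z = ∑ i : Fin l.length, predWeights k noiseVar l z i * y i := by
  have hs : (noisyGram k noiseVar l)⁻¹.transpose = (noisyGram k noiseVar l)⁻¹ := by
    have := (noisyGram_posDef hk hn l).inv.isHermitian
    rwa [Matrix.IsHermitian, Matrix.conjTranspose_eq_transpose_of_trivial] at this
  rw [postMean, Matrix.dotProduct_mulVec, ← Matrix.mulVec_transpose, hs]
  rfl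

theorem measurable_observation (hf : ∀ x, Measurable (f x)) (hw : ∀ t, Measurable (w t))
    (l : List D) (i : Fin l.length) : Measurable (observation noiseVar f w l i) :=
  (hf _).add ((hw _).const_mul _)

theorem measurable_predError (hf : ∀ x, Measurable (f x)) (hw : ∀ t, Measurable (w t))
    (l : List D) (z : D) : Measurable (predError k noiseVar f w l z) :=
  (hf z).sub (Finset.measurable_sum _ fun i _ => (measurable_observation hf hw l i).const_mul _)

variable (hw : IsStdNoise w f P)
include hw

theorem memLp_noise (t : ℕ) : MemLp (w t) 2 P := by
  have h : MemLp id 2 (P.map (w t)) := by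
    rw [hw.gaussian t]; exact memLp_id_gaussianReal' 2 (by simp)
  exact (memLp_map_measure_iff h.1 (hw.measurable t).aemeasurable).1 h

theorem integral_noise (t : ℕ) : ∫ ω, w t ω ∂P = 0 := by
  have h := integral_map (μ := P) (hw.measurable t).aemeasurable
    (f := fun u : ℝ => u) (by fun_prop)
  rw [hw.gaussian t, integral_id_gaussianReal] at h
  exact h.symm

theorem covariance_noise [IsProbabilityMeasure P] (s t : ℕ) :
    cov[w s, w t; P] = if s = t then 1 else 0 := by
  split_ifs with h
  · subst h
    rw [covariance_self (hw.measurable s).aemeasurable]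
    have h := variance_map (X := fun u : ℝ => u) (μ := P) (Y := w s) (by fun_prop)
      (hw.measurable s).aemeasurable
    rw [hw.gaussian s, variance_fun_id_gaussianReal] at h
    exact h.symm
  · exact (hw.indep.indepFun h).covariance_eq_zero (memLp_noise hw s) (memLp_noise hw t)

variable (hf : IsCenteredGP k f P)
include hf

theorem memLp_observation (l : List D) (i : Fin l.length) :
    MemLp (observation noiseVar f w l i) 2 P :=
  (hf.gaussian.hasGaussianLaw_eval _).memLp_two.add ((memLp_noise hw _).const_mul _)

theorem covariance_reward_noise [IsProbabilityMeasure P] (z : D) (t : ℕ) :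
    cov[f z, w t; P] = 0 := by
  have h : IndepFun (w t) (f z) P :=
    hw.indep_f.comp (φ := fun v : ℕ → ℝ => v t) (ψ := fun v : D → ℝ => v z)
      (measurable_pi_apply t) (measurable_pi_apply z)
  exact h.symm.covariance_eq_zero (hf.gaussian.hasGaussianLaw_eval z).memLp_two
    (memLp_noise hw t)

theorem covariance_reward_observation [IsProbabilityMeasure P] (l : List D) (z : D)
    (i : Fin l.length) : cov[f z, observation noiseVar f w l i; P] = k z (l.get i) := by
  have hz := (hf.gaussian.hasGaussianLaw_eval z).memLp_two
  have h1 := (hf.gaussian.hasGaussianLaw_eval (l.get i)).memLp_two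
  have h2 := (memLp_noise hw i).const_mul √(noiseVar (l.get i))
  have : observation noiseVar f w l i = f (l.get i) + fun ω => √(noiseVar (l.get i)) * w i ω := rfl
  rw [this, covariance_add_right hz h1 h2, covariance_const_mul_right,
    covariance_reward_noise hw hf, hf.covariance, mul_zero, add_zero]

theorem covariance_observation [IsProbabilityMeasure P] (hn : ∀ x, 0 < noiseVar x) (l : List D)
    (i j : Fin l.length) :
    cov[observation noiseVar f w l i, observation noiseVar f w l j; P] =
      noisyGram k noiseVar l i j := by
  have h1 := (hf.gaussian.hasGaussianLaw_eval (l.get i)).memLp_two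
  have h2 := (memLp_noise hw i).const_mul √(noiseVar (l.get i))
  have h3 := (memLp_noise hw j).const_mul √(noiseVar (l.get j))
  have h4 := (hf.gaussian.hasGaussianLaw_eval (l.get j)).memLp_two
  have e : ∀ i, observation noiseVar f w l i =
    f (l.get i) + fun ω => √(noiseVar (l.get i)) * w i ω := fun _ => rfl
  rw [e i, covariance_add_left h1 h2 (memLp_observation hw hf l j),
    covariance_reward_observation hw hf, e j, covariance_add_right h2 h4 h3,
    covariance_const_mul_left, covariance_const_mul_left, covariance_const_mul_right,
    covariance_comm, covariance_reward_noise hw hf, covariance_noise hw, noisyGram,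
    Matrix.add_apply, Matrix.of_apply, Matrix.diagonal_apply]
  by_cases hij : i = j
  · subst hij
    simp [Real.mul_self_sqrt (hn _).le]
  · simp [hij, Fin.val_inj]

/-- These are the normal equations: the optimal weights solve the linear system given by the noisy
Gram matrix. -/
theorem covariance_predError_observation [IsProbabilityMeasure P] (hk : (Matrix.of k).PosSemidef)
    (hn : ∀ x, 0 < noiseVar x) (l : List D) (z : D) (j : Fin l.length) :
    cov[predError k noiseVar f w l z, observation noiseVar f w l j; P] = 0 := by
  have hz := (hf.gaussian.hasGaussianLaw_eval z).memLp_two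
  have ho := fun i => (memLp_observation (noiseVar := noiseVar) hw hf l i)
  have e : predError k noiseVar f w l z = f z - fun ω => ∑ i, predWeights k noiseVar l z i *
    observation noiseVar f w l i ω := rfl
  rw [e, covariance_sub_left hz (memLp_finsetSum _ fun i _ => (ho i).const_mul _) (ho j),
    covariance_fun_sum_left (fun i => (ho i).const_mul _) (ho j),
    covariance_reward_observation hw hf]
  simp only [covariance_const_mul_left, covariance_observation hw hf hn]
  have h := congrFun (noisyGram_mulVec_predWeights hk hn l z) j
  have hs : ∀ i, noisyGram k noiseVar l i j = noisyGram k noiseVar l j i := fun i => by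
    simpa using (noisyGram_posDef hk hn l).isHermitian.apply j i
  rw [Matrix.mulVec, dotProduct, kernelVec, kernel_symm hk] at h
  rw [← h, sub_eq_zero]
  exact Finset.sum_congr rfl fun i _ => by rw [hs, mul_comm]

/-- The error is uncorrelated with the observations, so its variance equals its covariance with the
reward alone. -/
theorem variance_predError [IsProbabilityMeasure P] (hk : (Matrix.of k).PosSemidef)
    (hn : ∀ x, 0 < noiseVar x) (l : List D) (z : D) :
    Var[predError k noiseVar f w l z; P] = postVar k noiseVar l z := by
  have hz := (hf.gaussian.hasGaussianLaw_eval z).memLp_two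
  have ho := fun i => (memLp_observation (noiseVar := noiseVar) hw hf l i)
  have hsum : MemLp (fun ω => ∑ i, predWeights k noiseVar l z i *
    observation noiseVar f w l i ω) 2 P := memLp_finsetSum _ fun i _ => (ho i).const_mul _
  have e : predError k noiseVar f w l z = f z - fun ω => ∑ i, predWeights k noiseVar l z i *
    observation noiseVar f w l i ω := rfl
  have hp : MemLp (predError k noiseVar f w l z) 2 P := hz.sub hsum
  rw [← covariance_self (measurable_predError hf.measurable hw.measurable l z).aemeasurable]
  conv_lhs => rw [e, ← e]
  have h1 : cov[predError k noiseVar f w l z, f z - fun ω => ∑ i, predWeights k noiseVar l z i *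
      observation noiseVar f w l i ω; P] = cov[predError k noiseVar f w l z, f z; P] := by
    rw [covariance_sub_right hp hz hsum,
      covariance_fun_sum_right (fun i => (ho i).const_mul _) hp]
    simp only [covariance_const_mul_right, covariance_predError_observation hw hf hk hn, mul_zero,
      Finset.sum_const_zero, sub_zero]
  rw [← e] at h1
  rw [h1, e, covariance_sub_left hz hsum hz, covariance_fun_sum_left
    (fun i => (ho i).const_mul _) hz, hf.covariance]
  simp only [covariance_const_mul_left, covariance_comm (observation noiseVar f w l _),
    covariance_reward_observation hw hf]
  rw [postVar, dotProduct]
  congr 1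
  exact Finset.sum_congr rfl fun i _ => by
    rw [kernelVec, kernel_symm hk z, mul_comm]; rfl

theorem integral_predError [IsProbabilityMeasure P] (l : List D) (z : D) :
    ∫ ω, predError k noiseVar f w l z ω ∂P = 0 := by
  have ho := fun i => (memLp_observation (noiseVar := noiseVar) hw hf l i).integrable
    one_le_two
  have hz := (hf.gaussian.hasGaussianLaw_eval z).integrable
  have h1 : ∀ i, ∫ ω, observation noiseVar f w l i ω ∂P = 0 := fun i => by
    unfold observation
    rw [integral_add (hf.gaussian.hasGaussianLaw_eval _).integrable
      (((memLp_noise hw i).integrable one_le_two).const_mul _), hf.mean_zero,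
      integral_const_mul, integral_noise hw, mul_zero, add_zero]
  unfold predError
  rw [integral_sub hz (integrable_finsetSum _ fun i _ => (ho i).const_mul _), hf.mean_zero,
    integral_finsetSum _ fun i _ => (ho i).const_mul _]
  simp [integral_const_mul, h1]

/-- Joint Gaussianity is what turns zero covariance into independence. It holds because both
components are linear images of the reward and the noise, which are independent and Gaussian. -/
theorem hasGaussianLaw_predError_observation [Finite D] [IsProbabilityMeasure P] (l : List D)
    (z : D) :
    HasGaussianLaw (fun ω => (fun _ : Unit => predError k noiseVar f w l z ω,
      fun i => observation noiseVar f w l i ω)) P := by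
  have := Fintype.ofFinite D
  have h1 : HasGaussianLaw (fun ω x => f x ω) P := by
    have h := hf.gaussian.hasGaussianLaw Finset.univ
    let I : Finset D := Finset.univ
    let L : (I → ℝ) →L[ℝ] D → ℝ :=
      { toFun := fun v x => v ⟨x, Finset.mem_univ x⟩
        map_add' := fun _ _ => rfl
        map_smul' := fun _ _ => rfl }
    exact h.map L
  have h2 : HasGaussianLaw (fun ω (i : Fin l.length) => w i ω) P := by
    refine iIndepFun.hasGaussianLaw (fun i => ⟨?_⟩)
      (hw.indep.precomp (g := fun i : Fin l.length => (i : ℕ)) Fin.val_injective)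
    rw [hw.gaussian]
    infer_instance
  have h3 : IndepFun (fun ω x => f x ω) (fun ω (i : Fin l.length) => w i ω) P :=
    (hw.indep_f.comp (φ := fun v : ℕ → ℝ => fun i : Fin l.length => v i) (ψ := id)
      (by fun_prop) measurable_id).symm
  have h4 := h3.hasGaussianLaw h1 h2
  let O : (D → ℝ) × (Fin l.length → ℝ) →ₗ[ℝ] Fin l.length → ℝ :=
    { toFun := fun v i => v.1 (l.get i) + √(noiseVar (l.get i)) * v.2 i
      map_add' := fun u v => by
        ext i
        simp only [Prod.fst_add, Prod.snd_add, Pi.add_apply]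
        ring
      map_smul' := fun c v => by
        ext i
        simp only [Prod.smul_fst, Prod.smul_snd, Pi.smul_apply, smul_eq_mul, RingHom.id_apply]
        ring }
  let Z : (D → ℝ) × (Fin l.length → ℝ) →ₗ[ℝ] Unit → ℝ :=
    { toFun := fun v _ => v.1 z - ∑ i, predWeights k noiseVar l z i * O v i
      map_add' := fun u v => by
        ext
        simp only [map_add, Prod.fst_add, Pi.add_apply, mul_add, Finset.sum_add_distrib]
        ring
      map_smul' := fun c v => by
        ext
        simp only [map_smul, Prod.smul_fst, Pi.smul_apply, smul_eq_mul, RingHom.id_apply,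
          mul_sub, Finset.mul_sum]
        congr 1
        exact Finset.sum_congr rfl fun i _ => by ring }
  exact h4.map (Z.prod O).toContinuousLinearMap

theorem map_predError [Finite D] [IsProbabilityMeasure P] (hk : (Matrix.of k).PosSemidef)
    (hn : ∀ x, 0 < noiseVar x) (l : List D) (z : D) :
    P.map (predError k noiseVar f w l z) = gaussianReal 0 (postVar k noiseVar l z).toNNReal := by
  have h1 : HasGaussianLaw (predError k noiseVar f w l z) P :=
    (hasGaussianLaw_predError_observation (noiseVar := noiseVar) hw hf l z).fst.eval ()
  rw [h1.map_eq_gaussianReal, integral_predError hw hf, variance_predError hw hf hk hn]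

theorem indepFun_predError_observation [Finite D] [IsProbabilityMeasure P]
    (hk : (Matrix.of k).PosSemidef) (hn : ∀ x, 0 < noiseVar x) (l : List D) (z : D) :
    IndepFun (predError k noiseVar f w l z) (fun ω i => observation noiseVar f w l i ω) P := by
  have h := HasGaussianLaw.indepFun_of_covariance_eval
    (X := fun _ : Unit => predError k noiseVar f w l z) (Y := observation noiseVar f w l)
    (hasGaussianLaw_predError_observation (noiseVar := noiseVar) hw hf l z)
    (fun _ j => covariance_predError_observation hw hf hk hn l z j)
  exact h.comp (φ := fun v : Unit → ℝ => v ()) (ψ := id) (measurable_pi_apply ()) measurable_id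

end Posterior

/-! ### Confidence bounds under adaptive queries -/

section Adaptive

variable {D : Type*} {Ω : Type*} {mΩ : MeasurableSpace Ω} {P : Measure Ω}

/-- If the queries are determined by earlier observations, then the event that the queries form a
given list is determined by the observations that this list would give. -/
theorem measurableSet_queries_eq {noiseVar : D → ℝ} {f : D → Ω → ℝ} {w : ℕ → Ω → ℝ}
    {x : ℕ → Ω → D} {y : ℕ → Ω → ℝ}
    (hobs : ∀ t ω, y t ω = f (x t ω) ω + √(noiseVar (x t ω)) * w t ω)
    (hcaus : ∀ t d, MeasurableSet[⨆ s : Fin t, MeasurableSpace.comap (y s) inferInstance]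
      {ω | x t ω = d}) (l : List D) :
    MeasurableSet[MeasurableSpace.comap (fun ω i => observation noiseVar f w l i ω) inferInstance]
      {ω | ∀ i : Fin l.length, x i ω = l.get i} := by
  set 𝒢 := MeasurableSpace.comap (fun ω i => observation noiseVar f w l i ω) inferInstance
  have hO : Measurable[𝒢] (fun ω i => observation noiseVar f w l i ω) := comap_measurable _
  have ho : ∀ i : Fin l.length, Measurable[𝒢] (observation noiseVar f w l i) := fun i =>
    (measurable_pi_apply i).comp hO
  have key : ∀ m : ℕ, m ≤ l.length →
      MeasurableSet[𝒢] {ω | ∀ i : Fin l.length, (i : ℕ) < m → x i ω = l.get i} := by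
    intro m
    induction m with
    | zero => intro _; simp
    | succ m ih =>
      intro hm
      have hm' : m < l.length := hm
      have hF := ih hm'.le
      -- The next query is a function of the first `m` actual observations.
      obtain ⟨S, hS, hSe⟩ : ∃ S : Set (Fin m → ℝ), MeasurableSet S ∧
          (fun ω (s : Fin m) => y s ω) ⁻¹' S = {ω | x m ω = l.get ⟨m, hm'⟩} := by
        have h := hcaus m (l.get ⟨m, hm'⟩)
        have he : (⨆ s : Fin m, MeasurableSpace.comap (y s) inferInstance) =
            MeasurableSpace.comap (fun ω (s : Fin m) => y s ω) MeasurableSpace.pi := by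
          rw [MeasurableSpace.pi, MeasurableSpace.comap_iSup]
          simp only [MeasurableSpace.comap_comp]
          rfl
        rw [he] at h
        exact h
      have hset : {ω | ∀ i : Fin l.length, (i : ℕ) < m + 1 → x i ω = l.get i} =
          {ω | ∀ i : Fin l.length, (i : ℕ) < m → x i ω = l.get i} ∩
            (fun ω (s : Fin m) => observation noiseVar f w l ⟨s, s.2.trans hm'⟩ ω) ⁻¹' S := by
        -- As long as the queries agree with `l`, the actual observations are those that `l` would
        -- give, so the same set `S` decides the next query.
        have hy : ∀ ω, (∀ i : Fin l.length, (i : ℕ) < m → x i ω = l.get i) →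
            (ω ∈ (fun ω (s : Fin m) => observation noiseVar f w l ⟨s, s.2.trans hm'⟩ ω) ⁻¹' S ↔
              x m ω = l.get ⟨m, hm'⟩) := by
          intro ω hω
          have h1 : (fun (s : Fin m) => observation noiseVar f w l ⟨s, s.2.trans hm'⟩ ω) =
              fun (s : Fin m) => y s ω := by
            funext s
            have h2 := hω ⟨s, s.2.trans hm'⟩ s.2
            simp only at h2
            rw [hobs, h2, observation]
          have h3 : ω ∈ (fun ω (s : Fin m) => y s ω) ⁻¹' S ↔ x m ω = l.get ⟨m, hm'⟩ := by
            rw [hSe]; rfl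
          rw [← h3, Set.mem_preimage, Set.mem_preimage, h1]
        ext ω
        constructor
        · intro hω
          have h1 : ∀ i : Fin l.length, (i : ℕ) < m → x i ω = l.get i := fun i hi =>
            hω i (hi.trans m.lt_succ_self)
          exact ⟨h1, (hy ω h1).2 (hω ⟨m, hm'⟩ m.lt_succ_self)⟩
        · rintro ⟨h1, h2⟩ i hi
          rcases Nat.lt_succ_iff_lt_or_eq.1 hi with hi | hi
          · exact h1 i hi
          · have : i = ⟨m, hm'⟩ := Fin.ext hi
            rw [this]
            exact (hy ω h1).1 h2
      rw [hset]
      have hmeas : Measurable[𝒢] (fun ω (s : Fin m) =>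
          observation noiseVar f w l ⟨s, s.2.trans hm'⟩ ω) :=
        @measurable_pi_lambda _ _ _ 𝒢 _ _ fun s => ho _
      exact hF.inter (hmeas hS)
  have := key l.length le_rfl
  simpa using this

variable [Fintype D] [IsProbabilityMeasure P] {A : Input D} {f : D → Ω → ℝ} {w : ℕ → Ω → ℝ}
  {x : ℕ → Ω → D} {y : ℕ → Ω → ℝ}
  (hf : IsCenteredGP A.kernel f P) (hw : IsStdNoise w f P) (hrun : IsRun A f w x y)
  (hk : (Matrix.of A.kernel).PosSemidef) (hn : ∀ x, 0 < A.noiseVar x)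
  (h1 : ∀ x, A.kernel x x = 1)
include hf hw hrun hk hn h1

/-- The posterior confidence bound after `n` adaptive queries. -/
theorem measure_posterior_deviation_le (n : ℕ) (z : D) {s : ℝ} (hs : 0 ≤ s) :
    P {ω | s * postStd A.kernel A.noiseVar (history (fun t => x t ω) n) z <
      |f z ω - postMean A.kernel A.noiseVar (history (fun t => x t ω) n) (fun t => y t ω) z|} ≤
      ENNReal.ofReal (Real.exp (-(s ^ 2 / 2))) := by
  classical
  have hmE : ∀ l : List D, MeasurableSet {ω | ∀ i : Fin l.length, x i ω = l.get i} := fun l =>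
    Measurable.comap_le (measurable_pi_lambda _ fun i =>
      measurable_observation hf.measurable hw.measurable l i) _
      (measurableSet_queries_eq hrun.observation hrun.causal l)
  have hE : ∀ g : Fin n → D, (fun ω (i : Fin n) => x i ω) ⁻¹' {g} =
      {ω | ∀ i : Fin (List.ofFn g).length, x i ω = (List.ofFn g).get i} := by
    intro g
    ext ω
    simp only [Set.mem_preimage, Set.mem_singleton_iff, Set.mem_ofPred_eq, List.get_ofFn]
    constructor
    · rintro h i
      exact congrFun h (Fin.cast List.length_ofFn i)
    · intro h
      funext i
      exact h (Fin.cast List.length_ofFn.symm i)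
  have hhist : ∀ (g : Fin n → D) ω, ω ∈ (fun ω (i : Fin n) => x i ω) ⁻¹' {g} →
      history (fun t => x t ω) n = List.ofFn g := by
    intro g ω hω
    rw [Set.mem_preimage, Set.mem_singleton_iff] at hω
    rw [← hω, history, List.ofFn_eq_map, ← List.map_coe_finRange_eq_range, List.map_map]
    rfl
  -- The domain is finite, so there are finitely many query sequences `g`. For each, independence
  -- factors out the probability of the sequence, and these probabilities sum to at most `1`.
  have hone : ∀ g : Fin n → D,
      P ((fun ω (i : Fin n) => x i ω) ⁻¹' {g} ∩
        {ω | s * postStd A.kernel A.noiseVar (history (fun t => x t ω) n) z <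
          |f z ω - postMean A.kernel A.noiseVar (history (fun t => x t ω) n)
            (fun t => y t ω) z|}) ≤
      ENNReal.ofReal (Real.exp (-(s ^ 2 / 2))) * P ((fun ω (i : Fin n) => x i ω) ⁻¹' {g}) := by
    intro g
    set l := List.ofFn g with hl
    have hv := postVar_pos hk hn l z (by rw [h1]; exact one_pos)
    set c := s * postStd A.kernel A.noiseVar l z with hc
    have hc0 : 0 ≤ c := mul_nonneg hs (Real.sqrt_nonneg _)
    have hsub : (fun ω (i : Fin n) => x i ω) ⁻¹' {g} ∩
        {ω | s * postStd A.kernel A.noiseVar (history (fun t => x t ω) n) z <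
          |f z ω - postMean A.kernel A.noiseVar (history (fun t => x t ω) n)
            (fun t => y t ω) z|} ⊆
        predError A.kernel A.noiseVar f w l z ⁻¹' {u | c < |u|} ∩
          {ω | ∀ i : Fin l.length, x i ω = l.get i} := by
      rintro ω ⟨hω, hdev⟩
      have h2 := hhist g ω hω
      rw [hE g] at hω
      refine ⟨?_, hω⟩
      rw [Set.mem_ofPred_eq, h2, postMean_eq_sum hk hn] at hdev
      have h3 : predError A.kernel A.noiseVar f w l z ω =
          f z ω - ∑ i : Fin l.length, predWeights A.kernel A.noiseVar l z i * y i ω := by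
        rw [predError]
        congr 1
        refine Finset.sum_congr rfl fun i _ => ?_
        rw [hrun.observation, hω i, observation]
      rw [Set.mem_preimage, Set.mem_ofPred_eq, h3]
      exact hdev
    obtain ⟨S, hS, hSe⟩ := measurableSet_queries_eq hrun.observation hrun.causal l
    have hU : MeasurableSet {u : ℝ | c < |u|} := measurableSet_lt measurable_const (by fun_prop)
    have htail : P (predError A.kernel A.noiseVar f w l z ⁻¹' {u | c < |u|}) ≤
        ENNReal.ofReal (Real.exp (-(s ^ 2 / 2))) := by
      rw [← Measure.map_apply (measurable_predError hf.measurable hw.measurable l z) hU,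
        map_predError hw hf hk hn]
      refine (gaussianReal_abs_gt_le (Real.toNNReal_pos.2 hv).ne' hc0).trans_eq ?_
      rw [hc, postStd, mul_pow, Real.sq_sqrt hv.le, Real.coe_toNNReal _ hv.le]
      congr 3
      field_simp
    refine (measure_mono hsub).trans ?_
    rw [hE g, ← hSe, (indepFun_predError_observation hw hf hk hn l z).measure_inter_preimage_eq_mul
      _ _ hU hS]
    gcongr
  set bad := {ω | s * postStd A.kernel A.noiseVar (history (fun t => x t ω) n) z <
    |f z ω - postMean A.kernel A.noiseVar (history (fun t => x t ω) n) (fun t => y t ω) z|}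
  calc P bad ≤ P (⋃ g : Fin n → D, (fun ω (i : Fin n) => x i ω) ⁻¹' {g} ∩ bad) :=
        measure_mono fun ω hω => Set.mem_iUnion.2 ⟨fun i => x i ω, rfl, hω⟩
    _ ≤ ∑ g : Fin n → D, P ((fun ω (i : Fin n) => x i ω) ⁻¹' {g} ∩ bad) :=
        measure_iUnion_fintype_le _ _
    _ ≤ ∑ g : Fin n → D, ENNReal.ofReal (Real.exp (-(s ^ 2 / 2))) *
          P ((fun ω (i : Fin n) => x i ω) ⁻¹' {g}) := Finset.sum_le_sum fun g _ => hone g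
    _ = ENNReal.ofReal (Real.exp (-(s ^ 2 / 2))) *
          P ((fun ω (i : Fin n) => x i ω) ⁻¹' ↑(Finset.univ : Finset (Fin n → D))) := by
        rw [← Finset.mul_sum, sum_measure_preimage_singleton]
        intro g _
        rw [hE g]
        exact hmE _
    _ ≤ ENNReal.ofReal (Real.exp (-(s ^ 2 / 2))) * 1 := by gcongr; exact prob_le_one
    _ = _ := mul_one _

/-- With high probability, the posterior confidence bounds hold at all times. -/
theorem measure_exists_deviation_le (hcard : 1 ≤ Fintype.card D) {δ : ℝ} (hδ : 0 < δ)
    (hδ1 : δ < 1) :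
    P {ω | ∃ (t : ℕ) (z : D), √(2 * Real.log (Fintype.card D * ((t : ℝ) + 1) ^ 2 * Real.pi ^ 2 /
        (6 * δ))) * postStd A.kernel A.noiseVar (history (fun t => x t ω) (t + 1)) z <
      |f z ω - postMean A.kernel A.noiseVar (history (fun t => x t ω) (t + 1))
        (fun t => y t ω) z|} ≤ ENNReal.ofReal δ := by
  set N : ℝ := ((Fintype.card D : ℕ) : ℝ) with hN
  have hN1 : (1 : ℝ) ≤ N := by rw [hN]; exact_mod_cast hcard
  have hpi : (6 : ℝ) ≤ Real.pi ^ 2 := by nlinarith [Real.pi_gt_three]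
  have harg : ∀ t : ℕ, 1 ≤ N * ((t : ℝ) + 1) ^ 2 * Real.pi ^ 2 / (6 * δ) := by
    intro t
    rw [one_le_div (by positivity)]
    have h2 : (1 : ℝ) ≤ ((t : ℝ) + 1) ^ 2 := by
      have : (0 : ℝ) ≤ t := Nat.cast_nonneg t
      nlinarith
    have h3 : 1 ≤ N * ((t : ℝ) + 1) ^ 2 := one_le_mul_of_one_le_of_one_le hN1 h2
    nlinarith
  have hexp : ∀ t : ℕ, Real.exp (-(√(2 * Real.log (N * ((t : ℝ) + 1) ^ 2 * Real.pi ^ 2 /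
      (6 * δ))) ^ 2 / 2)) = 6 * δ / (N * Real.pi ^ 2) * (1 / ((t : ℝ) + 1) ^ 2) := by
    intro t
    have h0 := harg t
    rw [Real.sq_sqrt (mul_nonneg two_pos.le (Real.log_nonneg h0)), mul_div_cancel_left₀ _
      two_ne_zero, Real.exp_neg, Real.exp_log (by linarith)]
    field_simp
  -- The confidence width is chosen so that the failures at step `t + 1`, over all `N` points, have
  -- total probability `6 δ / (π² (t + 1)²)`.
  have hsum : HasSum (fun t : ℕ => N * (6 * δ / (N * Real.pi ^ 2) * (1 / ((t : ℝ) + 1) ^ 2))) δ := by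
    have h2 : HasSum (fun t : ℕ => 1 / ((t : ℝ) + 1) ^ 2) (Real.pi ^ 2 / 6) := by
      have := (hasSum_nat_add_iff' 1).2 hasSum_zeta_two
      simpa using this
    have h3 := (h2.mul_left (6 * δ / (N * Real.pi ^ 2))).mul_left N
    have hN0 : N ≠ 0 := by linarith
    have h4 : N * (6 * δ / (N * Real.pi ^ 2) * (Real.pi ^ 2 / 6)) = δ := by
      have := Real.pi_ne_zero
      field_simp
    rwa [h4] at h3
  have hset : {ω | ∃ (t : ℕ) (z : D), √(2 * Real.log (N * ((t : ℝ) + 1) ^ 2 * Real.pi ^ 2 /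
        (6 * δ))) * postStd A.kernel A.noiseVar (history (fun t => x t ω) (t + 1)) z <
      |f z ω - postMean A.kernel A.noiseVar (history (fun t => x t ω) (t + 1))
        (fun t => y t ω) z|} = ⋃ t : ℕ, ⋃ z : D,
      {ω | √(2 * Real.log (N * ((t : ℝ) + 1) ^ 2 * Real.pi ^ 2 / (6 * δ))) *
        postStd A.kernel A.noiseVar (history (fun t => x t ω) (t + 1)) z <
      |f z ω - postMean A.kernel A.noiseVar (history (fun t => x t ω) (t + 1))
        (fun t => y t ω) z|} := by
    ext ω
    simp only [Set.mem_iUnion, Set.mem_ofPred_eq]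
  rw [hset]
  refine (measure_iUnion_le _).trans ?_
  have hterm : ∀ t : ℕ, P (⋃ z : D,
      {ω | √(2 * Real.log (N * ((t : ℝ) + 1) ^ 2 * Real.pi ^ 2 / (6 * δ))) *
        postStd A.kernel A.noiseVar (history (fun t => x t ω) (t + 1)) z <
      |f z ω - postMean A.kernel A.noiseVar (history (fun t => x t ω) (t + 1))
        (fun t => y t ω) z|}) ≤
      ENNReal.ofReal (N * (6 * δ / (N * Real.pi ^ 2) * (1 / ((t : ℝ) + 1) ^ 2))) := by
    intro t
    refine (measure_iUnion_fintype_le _ _).trans ?_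
    refine (Finset.sum_le_sum fun z _ => measure_posterior_deviation_le hf hw hrun hk hn h1 (t + 1) z
      (Real.sqrt_nonneg _)).trans_eq ?_
    rw [hexp, Finset.sum_const, Finset.card_univ, nsmul_eq_mul,
      ENNReal.ofReal_mul (by positivity : (0 : ℝ) ≤ N), hN, ENNReal.ofReal_natCast]
  refine (ENNReal.tsum_le_tsum hterm).trans_eq ?_
  rw [← ENNReal.ofReal_tsum_of_nonneg (fun t => by positivity) hsum.summable, hsum.tsum_eq]

end Adaptive

/-! ### Numerical estimates for the horizon condition -/

section Numerics

/-- The constant `3` is `2 * 9 / 6`, from `N ≥ 2`, `π² ≥ 9` and `δ < 1`. -/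
theorem two_mul_log_le_betaT {N T m : ℕ} (hN : 2 ≤ N) {R δ : ℝ} (hR : 1 ≤ R) (hδ : 0 < δ)
    (hδ1 : δ < 1) (hm : 1 ≤ m) (hT : m ≤ T) : 2 * Real.log (3 * (m : ℝ) ^ 2) ≤ betaT N R δ T := by
  have hN' : (2 : ℝ) ≤ N := by exact_mod_cast hN
  have hm' : (1 : ℝ) ≤ m := by exact_mod_cast hm
  have hT' : (m : ℝ) ≤ T := by exact_mod_cast hT
  have hpi : (9 : ℝ) ≤ Real.pi ^ 2 := by nlinarith [Real.pi_gt_three]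
  refine mul_le_mul_of_nonneg_left (Real.log_le_log (by positivity) ?_) two_pos.le
  rw [le_div_iff₀ (by positivity)]
  have hR2 : 1 ≤ R ^ 2 := one_le_pow₀ hR
  calc 3 * (m : ℝ) ^ 2 * (6 * δ) ≤ 3 * (m : ℝ) ^ 2 * 6 := by gcongr; linarith
    _ = 2 * (m : ℝ) ^ 2 * 1 * 9 := by ring
    _ ≤ N * (T : ℝ) ^ 2 * R ^ 2 * Real.pi ^ 2 := by gcongr

theorem betaT_mono_right {N : ℕ} (hN : 1 ≤ N) {δ : ℝ} (hδ : 0 < δ) {u R : ℝ} {T : ℕ}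
    (hu : 0 < u) (h : u ≤ R * T) :
    2 * Real.log (N * u ^ 2 * Real.pi ^ 2 / (6 * δ)) ≤ betaT N R δ T := by
  have hN' : (1 : ℝ) ≤ N := by exact_mod_cast hN
  have hpi := Real.pi_pos
  refine mul_le_mul_of_nonneg_left (Real.log_le_log (by positivity) ?_) two_pos.le
  have h2 : u ^ 2 ≤ (R * T) ^ 2 := pow_le_pow_left₀ hu.le h 2
  have : (N : ℝ) * (T : ℝ) ^ 2 * R ^ 2 * Real.pi ^ 2 = N * (R * T) ^ 2 * Real.pi ^ 2 := by ring
  rw [this]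
  gcongr

/-- The sum of the first two terms of the horizon condition, per unit of `γ * β`. -/
theorem six_mul_le_horizon_terms {v γ β a ε : ℝ} (hv : 0 < v) (hε : 0 < ε) (ha : 1 ≤ a)
    (hεa : ε ≤ 4 * a) (hβ : 0 ≤ β) (hγ : 1 / 2 * Real.log (1 + v⁻¹) ≤ γ) :
    6 * β ≤ 2 * v * γ * β * (96 * a ^ 2 / ε ^ 2) +
      1 / Real.log (1 + v⁻¹) * γ * β * (6 * a ^ 2 / v) := by
  set s := v⁻¹ with hs
  have hs0 : 0 < s := inv_pos.2 hv
  have hvs : v * s = 1 := mul_inv_cancel₀ hv.ne'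
  set ℓ := Real.log (1 + s) with hℓ
  have hℓ1 : 2 * s / (2 + s) ≤ ℓ := le_log_one_add hs0.le
  have hℓ0 : 0 < ℓ := Real.log_pos (by linarith)
  have hγ0 : 0 < γ := by linarith
  have hq : 6 ≤ 96 * a ^ 2 / ε ^ 2 := by
    rw [le_div_iff₀ (by positivity)]
    nlinarith
  have h1 : 12 / (2 + s) ≤ 12 * v * γ := by
    rw [div_le_iff₀ (by positivity)]
    rw [div_le_iff₀ (by positivity)] at hℓ1
    have : 2 * s ≤ 2 * γ * (2 + s) := by nlinarith
    have := mul_le_mul_of_nonneg_left this hv.le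
    nlinarith
  have h2 : 3 * s ≤ 1 / ℓ * γ * (6 * a ^ 2 / v) := by
    have e1 : 1 / 2 ≤ 1 / ℓ * γ := by
      rw [one_div_mul_eq_div, le_div_iff₀ hℓ0]
      exact hγ
    have e2 : 6 * s ≤ 6 * a ^ 2 / v := by
      rw [div_eq_mul_inv, ← hs]
      have : 1 ≤ a ^ 2 := one_le_pow₀ ha
      nlinarith
    calc 3 * s = 1 / 2 * (6 * s) := by ring
      _ ≤ _ := mul_le_mul e1 e2 (by positivity) (by positivity)
  -- The first summand handles large noise and the second small noise, which makes the bound uniform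
  -- in `v`.
  have h3 : 6 ≤ 12 / (2 + s) + 3 * s := by
    rw [div_add' _ _ _ (by positivity), le_div_iff₀ (by positivity)]
    nlinarith
  have h4 : 12 * v * γ ≤ 2 * v * γ * (96 * a ^ 2 / ε ^ 2) := by
    have : 0 < 2 * v * γ := by positivity
    nlinarith
  calc 6 * β ≤ (2 * v * γ * (96 * a ^ 2 / ε ^ 2) + 1 / ℓ * γ * (6 * a ^ 2 / v)) * β :=
        mul_le_mul_of_nonneg_right (by linarith) hβ
    _ = _ := by ring

theorem one_le_log_factor {a d ε : ℝ} (hd : 0 < d) (hε : 0 < ε)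
    (hεa : d * ε ≤ 4 * a) : 1 ≤ 16 * a ^ 2 / (d ^ 2 * ε ^ 2) := by
  rw [one_le_div (by positivity)]
  have : (d * ε) ^ 2 ≤ (4 * a) ^ 2 := pow_le_pow_left₀ (by positivity) hεa 2
  nlinarith

theorem log_two_mul_le {a d ε β : ℝ} {N : ℕ} (hN : 2 ≤ N) (hd : 0 < d) (hε : 0 < ε)
    (hεa : d * ε ≤ 4 * a) (hβ : 0 < β) :
    Real.log (2 * β) ≤ Real.log (16 * a ^ 2 * N * β / (d ^ 2 * ε ^ 2)) := by
  have hN' : (2 : ℝ) ≤ N := by exact_mod_cast hN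
  refine Real.log_le_log (by positivity) ?_
  have e : 16 * a ^ 2 * N * β / (d ^ 2 * ε ^ 2) = 16 * a ^ 2 / (d ^ 2 * ε ^ 2) * (N * β) := by
    ring
  rw [e]
  calc 2 * β ≤ N * β := by gcongr
    _ ≤ _ := le_mul_of_one_le_left (by positivity) (one_le_log_factor hd hε hεa)

theorem log_two_pow_le {u : ℝ} (j : ℕ) (h : (2 : ℝ) ^ j ≤ u) : j * 0.6931 ≤ Real.log u := by
  have h1 := Real.log_le_log (by positivity) h
  rw [Real.log_pow] at h1
  have h2 := Real.log_two_gt_d9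
  have h3 : (0 : ℝ) ≤ j := Nat.cast_nonneg j
  nlinarith

/-- Every horizon that satisfies the condition is so long that the confidence parameter is not
small. -/
theorem twenty_le_betaT {N T : ℕ} (hN : 2 ≤ N) {R δ d ε v γ : ℝ} (hR : 1 ≤ R) (hδ : 0 < δ)
    (hδ1 : δ < 1) (hd : 0 < d) (hε : 0 < ε) (hε1 : ε ≤ 4 * (1 + d)) (hε2 : d * ε ≤ 4 * (1 + d))
    (hv : 0 < v) (hγ : 1 / 2 * Real.log (1 + v⁻¹) ≤ γ) (hT : 1 ≤ T)
    (h : HorizonCondition v γ (betaT N R δ T) d ε N T) : 20 ≤ betaT N R δ T := by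
  set β := betaT N R δ T with hβ
  have hstep : ∀ b : ℝ, ∀ j : ℕ, 0 < b → b ≤ β → (2 : ℝ) ^ j ≤ 2 * b →
      6 * b * (j * 0.6931) ≤ T := by
    intro b j hb hbβ hj
    have hβ0 : 0 < β := hb.trans_le hbβ
    have h1 := six_mul_le_horizon_terms hv hε (by linarith) hε1 hβ0.le hγ
    have h2 := log_two_mul_le (N := N) hN hd hε hε2 hβ0
    have h3 := log_two_pow_le j (hj.trans (by linarith : 2 * b ≤ 2 * β))
    refine le_trans ?_ h
    have h4 : (0 : ℝ) ≤ (⌈Real.logb 2 (32 * (1 + d) ^ 2 / (ε * √v))⌉₊ : ℝ) := Nat.cast_nonneg _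
    refine mul_le_mul (by linarith) (h3.trans h2) (by positivity) (by linarith)
  have hnat : ∀ m : ℕ, ∀ j : ℕ, 1 ≤ m → (m : ℝ) ≤ T → (2 : ℝ) ^ j ≤ 3 * (m : ℝ) ^ 2 →
      2 * (j * 0.6931) ≤ β := by
    intro m j hm hmT hj
    have h1 := two_mul_log_le_betaT (R := R) hN hR hδ hδ1 hm (by exact_mod_cast hmT : m ≤ T)
    have h2 := log_two_pow_le j hj
    linarith
  have b1 : 2 ≤ β := by
    have h1 := two_mul_log_le_betaT (R := R) hN hR hδ hδ1 le_rfl hT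
    have h2 : (1 : ℝ) ≤ Real.log (3 * ((1 : ℕ) : ℝ) ^ 2) := by
      rw [Real.le_log_iff_exp_le (by norm_num)]
      have := Real.exp_one_lt_d9
      norm_num
      linarith
    linarith
  -- Bootstrap between `T ≥ 6 β log (2 β)` and `β ≥ 2 log (3 T²)`: from `β ≥ 2` to `T ≥ 16`, `β ≥
  -- 12`, `T ≥ 199` and finally `β > 20`. Logarithms are bounded below through powers of two.
  have t1 := hstep 2 2 (by norm_num) b1 (by norm_num)
  have b2 := hnat 16 9 (by norm_num) (le_trans (by norm_num) t1) (by norm_num)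
  have t2 := hstep 12 4 (by norm_num) (by norm_num at b2; linarith) (by norm_num)
  have b3 := hnat 199 16 (by norm_num) (le_trans (by norm_num) t2) (by norm_num)
  norm_num at b3
  linarith

theorem succ_sq_le_three_mul_two_pow (m : ℕ) : (m + 1) ^ 2 ≤ 3 * 2 ^ m := by
  induction m using Nat.strong_induction_on with
  | _ m ih =>
    match m with
    | 0 => norm_num
    | 1 => norm_num
    | 2 => norm_num
    | m + 3 =>
      have := ih (m + 2) (by omega)
      rw [pow_succ 2 (m + 2)]
      have h2 : (m + 3 + 1) ^ 2 ≤ 2 * (m + 2 + 1) ^ 2 := by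
        ring_nf
        nlinarith [Nat.zero_le (m ^ 2)]
      omega

/-- With `X = √v * q` and `r = √s` one has `q = X * r`, so `(m + 1)² ≤ 3 * 2 ^ m ≤ 24 X r ≤ (3 (X +
r))²`. The term in `X` is absorbed by `X²` and a constant, the term in `r` by `s / ℓ ≥ √s / 2`. -/
theorem succ_le_of_two_pow_le {v s ℓ β q : ℝ} {m : ℕ} (hv : 0 < v) (hs : 0 < s)
    (hvs : v * s = 1) (hℓ : 0 < ℓ) (hℓs : ℓ ≤ s) (hℓs' : ℓ ≤ 2 * √s) (hq : 0 < q) (hβ : 20 ≤ β)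
    (hm : (2 : ℝ) ^ m ≤ 8 * q) :
    (m : ℝ) + 1 ≤ β * (32 / 3 * v * q ^ 2 + 3 * (s / ℓ)) := by
  have hsl : 1 ≤ s / ℓ := (one_le_div hℓ).2 hℓs
  have hsl2 : √s / 2 ≤ s / ℓ := by
    rw [le_div_iff₀ hℓ]
    calc √s / 2 * ℓ ≤ √s / 2 * (2 * √s) := by gcongr
      _ = √s * √s := by ring
      _ = s := Real.mul_self_sqrt hs.le
  have h1 : ((m : ℝ) + 1) ^ 2 ≤ 3 * 2 ^ m := by exact_mod_cast succ_sq_le_three_mul_two_pow m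
  set r := √s with hr
  have hr0 : 0 < r := Real.sqrt_pos.2 hs
  have hX : √v * r = 1 := by rw [hr, ← Real.sqrt_mul hv.le, hvs, Real.sqrt_one]
  have hX2 : v * q ^ 2 = (√v * q) ^ 2 := by rw [mul_pow, Real.sq_sqrt hv.le]
  set X := √v * q with hXdef
  have hX0 : 0 < X := mul_pos (Real.sqrt_pos.2 hv) hq
  have hqX : q = X * r := by rw [hXdef, mul_right_comm, hX, one_mul]
  rw [hqX] at hm
  have h2 : ((m : ℝ) + 1) ^ 2 ≤ (3 * (X + r)) ^ 2 := by
    refine h1.trans ?_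
    nlinarith [sq_nonneg (X - r)]
  have h3 : (m : ℝ) + 1 ≤ 3 * (X + r) := le_of_sq_le_sq h2 (by positivity)
  have h4 : 3 * (X + r) ≤ 20 * (32 / 3 * X ^ 2 + 3 * (s / ℓ)) := by
    nlinarith [sq_nonneg (X - 1)]
  rw [mul_assoc (32 / 3 : ℝ), hX2]
  exact (h3.trans h4).trans (mul_le_mul_of_nonneg_right hβ (by positivity))

theorem one_third_le_mul {v s ℓ γ : ℝ} (hv : 1 < v) (hs : 0 < s) (hvs : v * s = 1)
    (hℓ : 2 * s / (2 + s) ≤ ℓ) (hγ : 1 / 2 * ℓ ≤ γ) : 1 / 3 ≤ γ * v := by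
  have hs1 : s ≤ 1 := by nlinarith
  have h1 : 2 * s / 3 ≤ 2 * s / (2 + s) := by
    apply div_le_div_of_nonneg_left (by positivity) (by positivity) (by linarith)
  have h2 : s / 3 ≤ γ := by linarith
  calc 1 / 3 = s / 3 * v := by rw [div_mul_eq_mul_div, mul_comm s, hvs]
    _ ≤ γ * v := mul_le_mul_of_nonneg_right h2 (by linarith)

/-- For noise variance at most `1`, the logarithm in the horizon condition bounds the number of
epochs. -/
theorem add_two_le_logb {v a ε : ℝ} {m : ℕ} (hv : 0 < v) (hv1 : v ≤ 1) (hε : 0 < ε) (ha : 1 ≤ a)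
    (hm : (2 : ℝ) ^ m ≤ 8 * (a / ε)) :
    (m : ℝ) + 2 ≤ Real.logb 2 (32 * a ^ 2 / (ε * √v)) := by
  have hsv : √v ≤ 1 := Real.sqrt_le_one.2 hv1
  have hsv0 : 0 < √v := Real.sqrt_pos.2 hv
  have h1 : (2 : ℝ) ^ (m + 2) ≤ 32 * a ^ 2 / (ε * √v) := by
    calc (2 : ℝ) ^ (m + 2) = 4 * 2 ^ m := by ring
      _ ≤ 4 * (8 * (a / ε)) := by gcongr
      _ = 32 * a / ε := by ring
      _ ≤ 32 * a ^ 2 / (ε * √v) := by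
        apply div_le_div₀ (by positivity) _ (by positivity) _
        · nlinarith
        · nlinarith
  rw [Real.le_logb_iff_rpow_le one_lt_two (lt_of_lt_of_le (by positivity) h1)]
  exact_mod_cast h1

/-- The rounding errors in the numbers of queries of `m + 1` epochs fit into the slack of the
bound on the horizon. -/
theorem epochs_le_slack {v γ β a ε : ℝ} {m : ℕ} (hv : 0 < v) (hε : 0 < ε) (ha : 1 ≤ a)
    (hεa : ε ≤ 4 * a) (hβ : 20 ≤ β) (hγ : 1 / 2 * Real.log (1 + v⁻¹) ≤ γ)
    (hm : (2 : ℝ) ^ m ≤ 8 * (a / ε)) :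
    ((m : ℝ) + 1) * (γ + 1) ≤ 2 * v * γ * β * (32 / 3 * (a / ε) ^ 2) +
      1 / Real.log (1 + v⁻¹) * γ * β * (6 * a ^ 2 / v) +
      2 * (⌈Real.logb 2 (32 * a ^ 2 / (ε * √v))⌉₊ : ℝ) := by
  have hs0 : 0 < v⁻¹ := inv_pos.2 hv
  have hℓ1 := le_log_one_add hs0.le
  have hℓ2 := log_one_add_le_two_mul_sqrt hs0.le
  have hℓ3 : Real.log (1 + v⁻¹) ≤ v⁻¹ := by
    have := Real.log_le_sub_one_of_pos (show 0 < 1 + v⁻¹ by linarith)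
    linarith
  have hℓ0 : 0 < Real.log (1 + v⁻¹) := Real.log_pos (by linarith)
  have hvs : v * v⁻¹ = 1 := mul_inv_cancel₀ hv.ne'
  have hγ0 : 0 < γ := by linarith
  have hq1 : 1 / 4 ≤ a / ε := by rw [le_div_iff₀ hε]; linarith
  have ha2 : 1 ≤ a ^ 2 := one_le_pow₀ ha
  have hA := succ_le_of_two_pow_le hv hs0 hvs hℓ0 hℓ3 hℓ2 (by linarith) hβ hm
  have hC : γ * (β * (3 * (v⁻¹ / Real.log (1 + v⁻¹)))) ≤
      1 / Real.log (1 + v⁻¹) * γ * β * (6 * a ^ 2 / v) := by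
    have e : 1 / Real.log (1 + v⁻¹) * γ * β * (6 * a ^ 2 / v) =
        γ * (β * (6 * a ^ 2 * (v⁻¹ / Real.log (1 + v⁻¹)))) := by
      ring
    rw [e]
    gcongr
    linarith
  -- The ceilings cost `1` per epoch. For `v ≤ 1` the logarithmic term pays for this; for `v > 1`
  -- one has `γ v ≥ 1 / 3`, and half of the first term pays. The other half goes to the summand `γ`
  -- per epoch, bounded by `hA` and `hC`.
  have hB : (m : ℝ) + 1 ≤ γ * β * (32 / 3 * v * (a / ε) ^ 2) +
      2 * (⌈Real.logb 2 (32 * a ^ 2 / (ε * √v))⌉₊ : ℝ) := by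
    have h7 : (0 : ℝ) ≤ (⌈Real.logb 2 (32 * a ^ 2 / (ε * √v))⌉₊ : ℝ) := Nat.cast_nonneg _
    rcases le_or_gt v 1 with hv1 | hv1
    · have hnn : 0 ≤ γ * β * (32 / 3 * v * (a / ε) ^ 2) := by positivity
      have h3 := (add_two_le_logb hv hv1 hε ha hm).trans (Nat.le_ceil _)
      have h4 : (0 : ℝ) ≤ m := Nat.cast_nonneg m
      linarith
    · have h1 := one_third_le_mul hv1 hs0 hvs hℓ1 hγ
      have h2 : (m : ℝ) + 1 ≤ 2 ^ m := by exact_mod_cast Nat.lt_two_pow_self (n := m)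
      have h3 : (m : ℝ) + 1 ≤ 8 * (a / ε) := h2.trans hm
      have h4 : 1 / 3 * 20 ≤ γ * v * β := mul_le_mul h1 hβ (by norm_num) (by positivity)
      have h5 : 8 * (a / ε) ≤ 1 / 3 * 20 * (32 / 3 * (a / ε) ^ 2) := by
        generalize a / ε = q at hq1
        nlinarith
      have h6 := mul_le_mul_of_nonneg_right h4 (show 0 ≤ 32 / 3 * (a / ε) ^ 2 by positivity)
      have h8 : γ * v * β * (32 / 3 * (a / ε) ^ 2) = γ * β * (32 / 3 * v * (a / ε) ^ 2) := by ring
      linarith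
  have hA' := mul_le_mul_of_nonneg_left hA hγ0.le
  have e1 : γ * (β * (32 / 3 * v * (a / ε) ^ 2 + 3 * (v⁻¹ / Real.log (1 + v⁻¹)))) =
    γ * β * (32 / 3 * v * (a / ε) ^ 2) + γ * (β * (3 * (v⁻¹ / Real.log (1 + v⁻¹)))) := by ring
  have e2 : 2 * v * γ * β * (32 / 3 * (a / ε) ^ 2) =
    2 * (γ * β * (32 / 3 * v * (a / ε) ^ 2)) := by ring
  rw [e1] at hA'
  rw [e2]
  linarith

/-- The numbers of queries that suffice for the first `m + 1` epochs add up to at most the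
bracket in the horizon condition. -/
theorem sum_queries_le {v γ β a ε : ℝ} {m : ℕ} (hv : 0 < v) (hε : 0 < ε) (ha : 1 ≤ a)
    (hεa : ε ≤ 4 * a) (hβ : 20 ≤ β) (hγ : 1 / 2 * Real.log (1 + v⁻¹) ≤ γ)
    (hm : (2 : ℝ) ^ m ≤ 8 * (a / ε)) :
    ∑ i ∈ Finset.range (m + 1), (⌈2 * γ * (v * β * 4 ^ i + 1 / 2)⌉₊ : ℝ) ≤
      2 * v * γ * β * (96 * a ^ 2 / ε ^ 2) + 1 / Real.log (1 + v⁻¹) * γ * β * (6 * a ^ 2 / v) +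
      2 * (⌈Real.logb 2 (32 * a ^ 2 / (ε * √v))⌉₊ : ℝ) := by
  have hℓ0 : 0 < Real.log (1 + v⁻¹) := Real.log_pos (by linarith [inv_pos.2 hv])
  have hγ0 : 0 < γ := by linarith
  have h1 : ∀ i ∈ Finset.range (m + 1), (⌈2 * γ * (v * β * 4 ^ i + 1 / 2)⌉₊ : ℝ) ≤
      2 * v * γ * β * 4 ^ i + (γ + 1) := fun i _ => by
    have := Nat.ceil_lt_add_one (show 0 ≤ 2 * γ * (v * β * 4 ^ i + 1 / 2) by positivity)
    refine this.le.trans_eq ?_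
    ring
  have h2 := Finset.sum_le_sum h1
  rw [Finset.sum_add_distrib, ← Finset.mul_sum, Finset.sum_const, Finset.card_range,
    nsmul_eq_mul, geom_sum_eq (by norm_num)] at h2
  have h3 := epochs_le_slack hv hε ha hεa hβ hγ hm
  have h4 : ((4 : ℝ) ^ (m + 1) - 1) / (4 - 1) ≤ 256 / 3 * (a / ε) ^ 2 := by
    have e : (4 : ℝ) ^ m = (2 ^ m) ^ 2 := by rw [← pow_mul, mul_comm, pow_mul]; norm_num
    have := pow_le_pow_left₀ (by positivity) hm 2
    rw [pow_succ, e]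
    nlinarith
  have h5 : 2 * v * γ * β * (((4 : ℝ) ^ (m + 1) - 1) / (4 - 1)) ≤
      2 * v * γ * β * (256 / 3 * (a / ε) ^ 2) :=
    mul_le_mul_of_nonneg_left h4 (by positivity)
  -- The geometric sum uses `256 / 3` of the constant `96`; the remaining `32 / 3` is the slack for
  -- rounding.
  have e1 : 2 * v * γ * β * (96 * a ^ 2 / ε ^ 2) = 2 * v * γ * β * (256 / 3 * (a / ε) ^ 2) +
    2 * v * γ * β * (32 / 3 * (a / ε) ^ 2) := by ring
  push_cast at h2
  rw [e1]
  linarith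

/-- Writing `Q` for the fraction, the two hypotheses on `ε` give `Q ≥ 1` and `d² Q ≥ 1`. For `d ≥ 1`
the first suffices; for `d ≤ 1` the second gives `d Q ≥ 1` as well. -/
theorem three_le_mul_log_factor {d ε : ℝ} (hd : 0 < d) (hε : 0 < ε)
    (hε1 : ε ≤ 4 * (1 + d)) (hε2 : d * ε ≤ 4 * (1 + d)) :
    3 ≤ (2 * d + d ^ 2) * (16 * (1 + d) ^ 2 / (d ^ 2 * ε ^ 2)) := by
  have hQ := one_le_log_factor hd hε hε2
  set Q := 16 * (1 + d) ^ 2 / (d ^ 2 * ε ^ 2) with hQdef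
  have hQ2 : 1 ≤ d ^ 2 * Q := by
    have : d ^ 2 * Q = 16 * (1 + d) ^ 2 / ε ^ 2 := by rw [hQdef]; field_simp
    rw [this, one_le_div (by positivity)]
    nlinarith
  rcases le_total 1 d with h | h
  · nlinarith
  · have : d ^ 2 ≤ d := by nlinarith
    nlinarith

end Numerics

/-! ### Existence of the horizon -/

section Horizon

variable {D₀ : Type*} [Fintype D₀] [Nonempty D₀] {k₀ : D₀ → D₀ → ℝ}

/-- Long enough horizons satisfy the horizon condition. -/
theorem exists_horizonCondition (hk : (Matrix.of k₀).PosSemidef) (h1 : ∀ x, k₀ x x = 1) {v : ℝ}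
    (hv : 0 < v) {N : ℕ} (hN : 2 ≤ N) {R δ d ε : ℝ} (hR : 1 ≤ R) (hδ : 0 < δ) (hδ1 : δ < 1)
    (hd : 0 < d) (hε : 0 < ε) :
    ∃ T : ℕ, 1 ≤ T ∧ HorizonCondition v (maxInfoGain k₀ v T) (betaT N R δ T) d ε N T := by
  obtain ⟨A, hA, hγ⟩ := exists_maxInfoGain_le_mul_sqrt hk hv
  have hN' : (2 : ℝ) ≤ N := by exact_mod_cast hN
  have hℓ : 0 < Real.log (1 + v⁻¹) := Real.log_pos (by linarith [inv_pos.2 hv])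
  set κ := N * R ^ 2 * Real.pi ^ 2 / (6 * δ) with hκ
  set p := 2 * v * (96 * (1 + d) ^ 2 / ε ^ 2) +
    1 / Real.log (1 + v⁻¹) * (6 * (1 + d) ^ 2 / v) with hp
  set Q := 2 * (⌈Real.logb 2 (32 * (1 + d) ^ 2 / (ε * √v))⌉₊ : ℝ) with hQ
  set Z := 16 * (1 + d) ^ 2 * N / (d ^ 2 * ε ^ 2) with hZ
  set c := 2 * |Real.log κ| + 32 with hc
  have hp0 : 0 ≤ p := by positivity
  have hQ0 : 0 ≤ Q := by positivity
  have hZ0 : 0 < Z := by positivity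
  have hc0 : 0 < c := by positivity
  have hpi := Real.pi_pos
  have hκ0 : 0 < κ := by positivity
  set W := (p * A * c + Q) * (Z * c) with hW
  set M := ⌈W⌉₊ + 1 with hM
  have hM1 : (1 : ℝ) ≤ M := by exact_mod_cast Nat.le_add_left 1 _
  have hMW : W ≤ M := by
    rw [hM]; push_cast
    linarith [Nat.le_ceil W]
  have hM0 : (0 : ℝ) < M := by linarith
  have hT1 : 1 ≤ M ^ 8 := Nat.one_le_pow _ _ (Nat.succ_pos _)
  -- At `T = M ^ 8` the information gain is of order `M ^ 4`, while `β` and the logarithm are each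
  -- of order `M`. The left side is at most `W * M ^ 6` with `W ≤ M`, leaving a power of `M` to
  -- spare.
  refine ⟨M ^ 8, hT1, ?_⟩
  have hγT := hγ (M ^ 8) hT1
  have hγ0 : 0 ≤ maxInfoGain k₀ v (M ^ 8) :=
    le_trans (by positivity) (half_log_le_maxInfoGain hk h1 hv hT1)
  set γ := maxInfoGain k₀ v (M ^ 8)
  have hsq : √(((M ^ 8 : ℕ) : ℝ)) = (M : ℝ) ^ 4 := by
    push_cast
    rw [show (M : ℝ) ^ 8 = ((M : ℝ) ^ 4) ^ 2 by ring, Real.sqrt_sq (by positivity)]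
  rw [hsq] at hγT
  have hβ0 : 0 < betaT N R δ (M ^ 8) := by
    refine lt_of_lt_of_le ?_ (two_mul_log_le_betaT hN hR hδ hδ1 le_rfl hT1)
    have : 0 < Real.log (3 * ((1 : ℕ) : ℝ) ^ 2) := Real.log_pos (by norm_num)
    linarith
  have hβc : betaT N R δ (M ^ 8) ≤ c * M := by
    have e : (N : ℝ) * ((M ^ 8 : ℕ) : ℝ) ^ 2 * R ^ 2 * Real.pi ^ 2 / (6 * δ) = κ * (M : ℝ) ^ 16 := by
      rw [hκ]; push_cast; ring
    rw [betaT, e, Real.log_mul hκ0.ne' (by positivity), Real.log_pow]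
    have h2 := Real.log_le_sub_one_of_pos hM0
    have h3 := le_abs_self (Real.log κ)
    have h4 := abs_nonneg (Real.log κ)
    push_cast
    rw [hc]
    nlinarith
  set β := betaT N R δ (M ^ 8)
  have hlog : Real.log (16 * (1 + d) ^ 2 * N * β / (d ^ 2 * ε ^ 2)) ≤ Z * (c * M) := by
    have e : 16 * (1 + d) ^ 2 * N * β / (d ^ 2 * ε ^ 2) = Z * β := by rw [hZ]; ring
    rw [e]
    refine (Real.log_le_self (by positivity)).trans ?_
    gcongr
  have hbr : 2 * v * γ * β * (96 * (1 + d) ^ 2 / ε ^ 2) +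
      1 / Real.log (1 + v⁻¹) * γ * β * (6 * (1 + d) ^ 2 / v) + Q ≤ (p * A * c + Q) * (M : ℝ) ^ 5 := by
    have e : 2 * v * γ * β * (96 * (1 + d) ^ 2 / ε ^ 2) +
      1 / Real.log (1 + v⁻¹) * γ * β * (6 * (1 + d) ^ 2 / v) = p * (γ * β) := by rw [hp]; ring
    have h2 : γ * β ≤ A * (M : ℝ) ^ 4 * (c * M) := mul_le_mul hγT hβc hβ0.le (by positivity)
    have h3 : p * (γ * β) ≤ p * (A * (M : ℝ) ^ 4 * (c * M)) := mul_le_mul_of_nonneg_left h2 hp0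
    have h4 : Q ≤ Q * (M : ℝ) ^ 5 := le_mul_of_one_le_right hQ0 (one_le_pow₀ hM1)
    rw [e]
    calc p * (γ * β) + Q ≤ p * (A * (M : ℝ) ^ 4 * (c * M)) + Q * (M : ℝ) ^ 5 := by linarith
      _ = _ := by ring
  have hbr0 : 0 ≤ 2 * v * γ * β * (96 * (1 + d) ^ 2 / ε ^ 2) +
      1 / Real.log (1 + v⁻¹) * γ * β * (6 * (1 + d) ^ 2 / v) + Q := by positivity
  rw [HorizonCondition]
  calc _ ≤ (p * A * c + Q) * (M : ℝ) ^ 5 * (Z * (c * M)) :=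
        (mul_le_mul_of_nonneg_left hlog hbr0).trans
          (mul_le_mul_of_nonneg_right hbr (by positivity))
    _ = W * (M : ℝ) ^ 6 := by rw [hW]; ring
    _ ≤ M * (M : ℝ) ^ 6 := by gcongr
    _ = (M : ℝ) ^ 7 * 1 := by ring
    _ ≤ (M : ℝ) ^ 7 * M := by gcongr
    _ = ((M ^ 8 : ℕ) : ℝ) := by push_cast; ring

/-- The infimum of an empty set of naturals would be `0`; existence of a feasible horizon makes the
minimum satisfy the condition. -/
theorem minHorizon_spec (hk : (Matrix.of k₀).PosSemidef) (h1 : ∀ x, k₀ x x = 1) {v : ℝ}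
    (hv : 0 < v) {N : ℕ} (hN : 2 ≤ N) {R δ d ε : ℝ} (hR : 1 ≤ R) (hδ : 0 < δ) (hδ1 : δ < 1)
    (hd : 0 < d) (hε : 0 < ε) :
    1 ≤ minHorizon k₀ N R δ d ε v ∧
      HorizonCondition v (maxInfoGain k₀ v (minHorizon k₀ N R δ d ε v))
        (betaT N R δ (minHorizon k₀ N R δ d ε v)) d ε N (minHorizon k₀ N R δ d ε v) :=
  Nat.sInf_mem (exists_horizonCondition hk h1 hv hN hR hδ hδ1 hd hε)

end Horizon

/-! ### Choosing the confidence parameters -/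

/-- The parameters of epoch `i` may depend on the total budget of the earlier epochs, so the choices
are made along with that total by recursion. -/
theorem exists_budget_sequence {p : ℕ → ℝ → ℝ → ℝ → ℝ → Prop}
    (h : ∀ i V, ∃ β C F, p i V β C F) :
    ∃ β C F V : ℕ → ℝ, V 0 = 0 ∧ (∀ i, V (i + 1) = V i + C i * F i) ∧
      ∀ i, p i (V i) (β i) (C i) (F i) := by
  choose β C F hp using h
  let V : ℕ → ℝ := fun n => Nat.rec 0 (fun i V => V + C i V * F i V) n
  exact ⟨fun i => β i (V i), fun i => C i (V i), fun i => F i (V i), V, rfl, fun _ => rfl,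
    fun i => hp i (V i)⟩

/-- The sixth power of `b` is negligible against `exp (b / 2)`. The cube in the bound on `u` is the
growth of an epoch's budget in its parameter. -/
theorem eventually_two_mul_log_le {κ U : ℝ} (hκ : 0 < κ) :
    ∀ᶠ b : ℝ in Filter.atTop, ∀ u : ℝ, |u| ≤ U * b ^ 3 → 2 * Real.log (κ * u ^ 2) ≤ b := by
  have hlo := isLittleO_pow_exp_pos_mul_atTop 6 (show (0 : ℝ) < 1 / 2 by norm_num)
  have hc : 0 < (κ * U ^ 2 + 1)⁻¹ := by positivity
  filter_upwards [hlo.bound hc, Filter.eventually_ge_atTop (0 : ℝ)] with b hb hb0 u hu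
  rcases eq_or_ne u 0 with rfl | hu0
  · simpa using hb0
  rw [Real.norm_of_nonneg (by positivity), Real.norm_of_nonneg (Real.exp_pos _).le] at hb
  have h1 : κ * u ^ 2 ≤ Real.exp (1 / 2 * b) := by
    have h2 : u ^ 2 ≤ (U * b ^ 3) ^ 2 := by
      rw [← sq_abs]
      exact pow_le_pow_left₀ (abs_nonneg u) hu 2
    calc κ * u ^ 2 ≤ κ * (U * b ^ 3) ^ 2 := by gcongr
      _ = κ * U ^ 2 * b ^ 6 := by ring
      _ ≤ (κ * U ^ 2 + 1) * b ^ 6 := by gcongr; linarith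
      _ ≤ (κ * U ^ 2 + 1) * ((κ * U ^ 2 + 1)⁻¹ * Real.exp (1 / 2 * b)) := by gcongr
      _ = _ := by field_simp
  have h3 := Real.log_le_log (by positivity) h1
  rw [Real.log_exp] at h3
  linarith

theorem sum_map_cost_eq {D₀ : Type*} {K : ℕ} {c : Fin K → ℝ} {l : List (D₀ × Fin K)} {j : Fin K} (hl : ∀ p ∈ l, p.2 = j) :
    (l.map fun p => c p.2).sum = c j * l.length := by
  have : (l.map fun p => c p.2) = l.map fun _ => c j :=
    List.map_congr_left fun p hp => by rw [hl p hp]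
  rw [this, List.map_const', List.sum_replicate, nsmul_eq_mul, mul_comm]

section Choice

variable {D₀ : Type*} [Fintype D₀] [Nonempty D₀] {K : ℕ} {k₀ : D₀ → D₀ → ℝ} {σ2 c : Fin K → ℝ}

/-- A confidence parameter that is large enough for its own epoch, given the cost `V` of the
earlier ones. -/
theorem exists_confidence_parameter (hk : (Matrix.of k₀).PosSemidef) (hσ : ∀ j, 0 < σ2 j)
    (hc : ∀ j, 0 < c j) (j : Fin K) {θ e κ N : ℝ} (hθ : 0 < θ) (he : 0 < e) (hκ : 0 < κ)
    (hN : 0 ≤ N) (V : ℝ) :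
    ∃ β C : ℝ, 20 ≤ β ∧ 0 < C ∧
      (∃ S : List (D₀ × Fin K), (S.map fun p => c p.2).sum = C ∧ ∀ z,
        β * postVar (fun p q : D₀ × Fin K => k₀ p.1 q.1) (fun p => σ2 p.2) S z ≤ e) ∧
      2 * Real.log (κ * (V + C * (1 + N * β / θ)) ^ 2) ≤ β := by
  obtain ⟨A, hA, hγ⟩ := exists_maxInfoGain_le_mul_sqrt hk (hσ j)
  set s := σ2 j / e with hs
  have hs0 : 0 < s := div_pos (hσ j) he
  have hcj := hc j
  obtain ⟨β, hlog, hβ⟩ := ((eventually_two_mul_log_le (κ := κ)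
    (U := |V| + c j * ((2 * A * (s + 1)) ^ 2 + 2) * (1 + N / θ)) hκ).and
    (Filter.eventually_ge_atTop 20)).exists
  have hβ0 : 0 < β := by linarith
  have hβ1 : 1 ≤ β := by linarith
  -- With information gain at most `A √n`, the covering condition reduces to `2 A (s β + 1 / 2) ≤
  -- √n`. So `n` is of order `β²`, and the epoch's budget, with its factor of order `β`, is of order
  -- `β³`.
  set n := ⌈(2 * A * (s * β + 1 / 2)) ^ 2⌉₊ + 1 with hn
  have hn1 : 1 ≤ n := Nat.le_add_left 1 _
  have hn2 : (2 * A * (s * β + 1 / 2)) ^ 2 ≤ n := by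
    rw [hn]; push_cast
    linarith [Nat.le_ceil ((2 * A * (s * β + 1 / 2)) ^ 2)]
  have hn3 : (n : ℝ) ≤ ((2 * A * (s + 1)) ^ 2 + 2) * β ^ 2 := by
    have h1 := (Nat.ceil_lt_add_one (sq_nonneg (2 * A * (s * β + 1 / 2)))).le
    have h2 : (2 * A * (s * β + 1 / 2)) ^ 2 ≤ (2 * A * (s + 1)) ^ 2 * β ^ 2 := by
      rw [← mul_pow]
      apply pow_le_pow_left₀ (by positivity)
      have h3 : s * β + 1 / 2 ≤ (s + 1) * β := by linarith
      calc 2 * A * (s * β + 1 / 2) ≤ 2 * A * ((s + 1) * β) := by gcongr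
        _ = _ := by ring
    have h3 : 1 ≤ β ^ 2 := one_le_pow₀ hβ1
    rw [hn]; push_cast
    nlinarith
  obtain ⟨S, hlen, hlev, hS⟩ := exists_cover_of_le hk hσ j (div_pos he hβ0) hn1 (by
    have h1 := hγ n hn1
    have h2 : σ2 j / (e / β) = s * β := by rw [hs]; field_simp
    have h3 : 2 * A * (s * β + 1 / 2) ≤ √n := Real.le_sqrt_of_sq_le hn2
    rw [h2]
    calc 2 * maxInfoGain k₀ (σ2 j) n * (s * β + 1 / 2)
        ≤ 2 * (A * √n) * (s * β + 1 / 2) := by gcongr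
      _ = 2 * A * (s * β + 1 / 2) * √n := by ring
      _ ≤ √n * √n := by gcongr
      _ = n := Real.mul_self_sqrt (Nat.cast_nonneg n))
  have hn0 : (0 : ℝ) < n := by exact_mod_cast hn1
  refine ⟨β, c j * n, hβ, by positivity, ⟨S, ?_, fun z => ?_⟩, hlog _ ?_⟩
  · rw [sum_map_cost_eq hlev, hlen]
  · have := mul_le_mul_of_nonneg_left (hS z) hβ0.le
    rwa [mul_div_cancel₀ _ hβ0.ne'] at this
  · have h1 : 1 + N * β / θ ≤ (1 + N / θ) * β := by
      have : N * β / θ = N / θ * β := by ring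
      rw [this]
      nlinarith
    have h2 : 0 ≤ N * β / θ := by positivity
    have h4 : |V| ≤ |V| * β ^ 3 := le_mul_of_one_le_right (abs_nonneg V) (one_le_pow₀ hβ1)
    have h3 : c j * n * (1 + N * β / θ) ≤
        c j * (((2 * A * (s + 1)) ^ 2 + 2) * β ^ 2) * ((1 + N / θ) * β) := by
      gcongr
    have h5 : |c j * n * (1 + N * β / θ)| = c j * n * (1 + N * β / θ) :=
      abs_of_nonneg (by positivity)
    calc |V + c j * n * (1 + N * β / θ)| ≤ |V| + |c j * n * (1 + N * β / θ)| := abs_add_le _ _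
      _ = |V| + c j * n * (1 + N * β / θ) := by rw [h5]
      _ ≤ |V| * β ^ 3 + c j * (((2 * A * (s + 1)) ^ 2 + 2) * β ^ 2) * ((1 + N / θ) * β) := by
        linarith
      _ = _ := by ring

/-- The number of queries at noise level `j` that suffices for an early epoch. -/
theorem exists_early_cover (hk : (Matrix.of k₀).PosSemidef) (h1 : ∀ x, k₀ x x = 1)
    (hσ : ∀ j, 0 < σ2 j) (j : Fin K) {T : ℕ} (hT : 1 ≤ T) {β : ℝ} (hβ : 0 < β) (i : ℕ)
    (hn : ⌈2 * maxInfoGain k₀ (σ2 j) T * (σ2 j * β * 4 ^ i + 1 / 2)⌉₊ ≤ T) :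
    ∃ S : List (D₀ × Fin K), (S.map fun p => c p.2).sum =
        c j * ⌈2 * maxInfoGain k₀ (σ2 j) T * (σ2 j * β * 4 ^ i + 1 / 2)⌉₊ ∧
      ∀ z, β * postVar (fun p q : D₀ × Fin K => k₀ p.1 q.1) (fun p => σ2 p.2) S z ≤
        ((1 / 2) ^ i) ^ 2 := by
  have hσj := hσ j
  have hγ0 : 0 < maxInfoGain k₀ (σ2 j) T := lt_of_lt_of_le
    (mul_pos (by norm_num) (Real.log_pos (by linarith [inv_pos.2 hσj])))
    (half_log_le_maxInfoGain hk h1 hσj hT)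
  set n := ⌈2 * maxInfoGain k₀ (σ2 j) T * (σ2 j * β * 4 ^ i + 1 / 2)⌉₊ with hndef
  have hn1 : 1 ≤ n := Nat.ceil_pos.2 (by positivity)
  have he : (((1 : ℝ) / 2) ^ i) ^ 2 = 1 / 4 ^ i := by
    rw [← pow_mul, mul_comm, pow_mul, ← one_div_pow]; norm_num
  obtain ⟨S, hlen, hlev, hS⟩ := exists_cover_of_le (v := 1 / (4 ^ i * β)) hk hσ j (by positivity)
    hn1 (by
      have h2 : σ2 j / (1 / (4 ^ i * β)) = σ2 j * β * 4 ^ i := by field_simp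
      rw [h2]
      refine le_trans ?_ (Nat.le_ceil _)
      -- Covering with `n` queries needs the information gain at `n`; since `n ≤ T` it is at most
      -- the one at `T` that defines `n`.
      have := maxInfoGain_mono hk h1 hσj hn
      gcongr)
  refine ⟨S, by rw [sum_map_cost_eq hlev, hlen], fun z => ?_⟩
  have := mul_le_mul_of_nonneg_left (hS z) hβ.le
  refine this.trans_eq ?_
  rw [he]
  field_simp

end Choice

/-! ### Bounds on the potential at the start of an epoch -/

section Potential

variable {D : Type*} [Fintype D] {A : Input D}

theorem Input.potential_le_card_mul (hk : (Matrix.of A.kernel).PosSemidef)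
    (hn : ∀ x, 0 < A.noiseVar x) (h1 : ∀ x, A.kernel x x = 1) {i : ℕ} (hβ : 0 ≤ A.β i)
    (M : Finset D) (l : List D) : A.potential i M l ≤ Fintype.card D * A.β i := by
  have h2 : ∀ z ∈ (Finset.univ : Finset D), max (A.β i * postVar A.kernel A.noiseVar l z)
      (A.η i ^ 2) - A.η i ^ 2 ≤ A.β i := by
    intro z _
    have h3 := postVar_le_prior hk hn l z
    rw [h1] at h3
    have h4 : A.β i * postVar A.kernel A.noiseVar l z ≤ A.β i := mul_le_of_le_one_right hβ h3
    have h5 := sq_nonneg (A.η i)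
    rw [sub_le_iff_le_add]
    exact max_le (by linarith) (by linarith)
  refine (A.potential_mono (Finset.subset_univ M) l).trans ((Finset.sum_le_sum h2).trans_eq ?_)
  rw [Finset.sum_const, Finset.card_univ, nsmul_eq_mul]

/-- Passing the test at target `2 η` with an unchanged parameter leaves `β σ² ≤ 4 (1 + δbar)² η²`.
-/
theorem Input.potential_le_of_epochDone (hk : (Matrix.of A.kernel).PosSemidef)
    (hn : ∀ x, 0 < A.noiseVar x) (h1 : ∀ x, A.kernel x x = 1) (hd : 0 < A.δbar)
    (hr : A.r = 1 / 2) {i : ℕ} (hβ : 0 ≤ A.β i) (hβi : A.β (i + 1) = A.β i)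
    {M : Finset D} {l : List D} (h : A.EpochDone i M l) :
    A.potential (i + 1) M l ≤ Fintype.card D * ((4 * (1 + A.δbar) ^ 2 - 1) * A.η (i + 1) ^ 2) := by
  have hηi : A.η i = 2 * A.η (i + 1) := by
    rw [Input.η, Input.η, hr, pow_succ]; ring
  have hd2 : 1 ≤ (1 + A.δbar) ^ 2 := one_le_pow₀ (by linarith)
  have hη2 := sq_nonneg (A.η (i + 1))
  have h2 : ∀ z ∈ M, max (A.β (i + 1) * postVar A.kernel A.noiseVar l z) (A.η (i + 1) ^ 2) -
      A.η (i + 1) ^ 2 ≤ (4 * (1 + A.δbar) ^ 2 - 1) * A.η (i + 1) ^ 2 := by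
    intro z hz
    have hv := postVar_pos hk hn l z (by rw [h1]; exact one_pos)
    have h3 := pow_le_pow_left₀ (mul_nonneg (Real.sqrt_nonneg _) (Real.sqrt_nonneg _)) (h z hz) 2
    rw [mul_pow, Real.sq_sqrt hβ, Real.sq_sqrt hv.le, hηi] at h3
    have h4 : A.β (i + 1) * postVar A.kernel A.noiseVar l z ≤
        4 * (1 + A.δbar) ^ 2 * A.η (i + 1) ^ 2 := by
      rw [hβi]
      refine h3.trans_eq ?_
      ring
    rw [sub_le_iff_le_add]
    exact max_le (by linarith) (by nlinarith)
  refine (Finset.sum_le_sum h2).trans ?_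
  rw [Finset.sum_const, nsmul_eq_mul]
  have h5 : (M.card : ℝ) ≤ Fintype.card D := by exact_mod_cast Finset.card_le_univ M
  have h6 : 0 ≤ 4 * (1 + A.δbar) ^ 2 - 1 := by linarith
  gcongr

end Potential

/-! ### Lifting the model to pairs of a point and a noise level -/

section Lift

variable {D₀ : Type*} {K : ℕ} {Ω : Type*} [MeasurableSpace Ω] {P : Measure Ω}
  {k₀ : D₀ → D₀ → ℝ} {f₀ : D₀ → Ω → ℝ} {w : ℕ → Ω → ℝ}

theorem IsCenteredGP.lift (h : IsCenteredGP k₀ f₀ P) :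
    IsCenteredGP (fun p q : D₀ × Fin K => k₀ p.1 q.1) (fun p => f₀ p.1) P where
  measurable p := h.measurable p.1
  gaussian := h.gaussian.comp_right Prod.fst
  mean_zero p := h.mean_zero p.1
  covariance p q := h.covariance p.1 q.1

theorem IsStdNoise.lift (h : IsStdNoise w f₀ P) :
    IsStdNoise w (fun p : D₀ × Fin K => f₀ p.1) P where
  measurable := h.measurable
  gaussian := h.gaussian
  indep := h.indep
  indep_f := h.indep_f.comp (φ := id) (ψ := fun (v : D₀ → ℝ) (p : D₀ × Fin K) => v p.1)
    measurable_id (by fun_prop)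

end Lift

/-- The first `m` with the required accuracy is taken: its predecessor is not accurate enough, which
gives the upper bound on `2 ^ m`. For `m = 0` that bound is the hypothesis `ε ≤ 4 * a`. -/
theorem exists_last_epoch {a ε : ℝ} (ha : 0 < a) (hε : 0 < ε) (hεa : ε ≤ 4 * a) :
    ∃ m : ℕ, 4 * (a * (1 / 2) ^ m) ≤ ε ∧ (2 : ℝ) ^ m ≤ 8 * (a / ε) := by
  classical
  have hex : ∃ m : ℕ, 4 * (a * (1 / 2) ^ m) ≤ ε := by
    obtain ⟨m, hm⟩ := exists_pow_lt_of_lt_one (show 0 < ε / (4 * a) by positivity)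
      (show (1 / 2 : ℝ) < 1 by norm_num)
    rw [lt_div_iff₀ (by positivity)] at hm
    exact ⟨m, by linarith⟩
  refine ⟨Nat.find hex, Nat.find_spec hex, ?_⟩
  rcases hm : Nat.find hex with _ | m
  · rw [pow_zero, ← mul_div_assoc, one_le_div hε]
    linarith
  · have h1 := Nat.find_min hex (m := m) (by omega)
    rw [not_le, one_div_pow] at h1
    have h2 : ε * 2 ^ m < 4 * a := by
      have := mul_lt_mul_of_pos_right h1 (show (0 : ℝ) < 2 ^ m by positivity)
      have e : 4 * (a * (1 / 2 ^ m)) * (2 : ℝ) ^ m = 4 * a := by field_simp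
      rwa [e] at this
    rw [pow_succ, ← mul_div_assoc, le_div_iff₀ hε]
    linarith

/-! ### Assembling the budgets -/

section Assembly

/-- The same logarithm `L` serves the first epoch and the later early ones. With `g = 2 d + d²` and
`Q` the fraction without `N β`, the right side is `g Q N β / e`, and `g Q ≥ 3 > e`. For the second
bound, `3 + 4 g ≤ 5 g Q` and `5 e < 20 ≤ β`. -/
theorem initial_potential_bounds_le {N d ε β L : ℝ} (hN : 0 < N) (hd : 0 < d) (hε : 0 < ε)
    (hε1 : ε ≤ 4 * (1 + d)) (hε2 : d * ε ≤ 4 * (1 + d)) (hβ : 20 ≤ β)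
    (hL : L = Real.log (16 * (1 + d) ^ 2 * N * β / (d ^ 2 * ε ^ 2))) :
    N * β ≤ Real.exp (L - 1) * (2 * d + d ^ 2) ∧
      N * (4 * (1 + d) ^ 2 - 1) ≤ Real.exp (L - 1) * (2 * d + d ^ 2) := by
  have hβ0 : 0 < β := by linarith
  have hQ1 := one_le_log_factor hd hε hε2
  have hgQ := three_le_mul_log_factor hd hε hε1 hε2
  have he := Real.exp_one_lt_d9
  have he0 := Real.exp_pos 1
  have hexp : Real.exp (L - 1) = 16 * (1 + d) ^ 2 / (d ^ 2 * ε ^ 2) * (N * β) / Real.exp 1 := by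
    rw [Real.exp_sub, hL, Real.exp_log (by positivity)]
    congr 1
    ring
  rw [hexp]
  set Q := 16 * (1 + d) ^ 2 / (d ^ 2 * ε ^ 2)
  set g := 2 * d + d ^ 2 with hg
  have hg0 : 0 < g := by positivity
  have e1 : Q * (N * β) / Real.exp 1 * g = g * Q * (N * β) / Real.exp 1 := by ring
  have e2 : 4 * (1 + d) ^ 2 - 1 = 3 + 4 * g := by rw [hg]; ring
  rw [e1, e2, le_div_iff₀ he0, le_div_iff₀ he0]
  have hNβ : 0 < N * β := by positivity
  constructor
  · calc N * β * Real.exp 1 ≤ N * β * (g * Q) := by gcongr; linarith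
      _ = _ := by ring
  · have h1 : 3 + 4 * g ≤ 5 * (g * Q) := by nlinarith
    calc N * (3 + 4 * g) * Real.exp 1 ≤ N * (5 * (g * Q)) * 4 := by
          gcongr; linarith
      _ = g * Q * (N * 20) := by ring
      _ ≤ g * Q * (N * β) := by gcongr

variable {D₀ : Type*} {K : ℕ} {k₀ : D₀ → D₀ → ℝ} {σ2 c : Fin K → ℝ}

/-- The confidence parameters, and the resulting bounds on the cost of the epochs. Up to epoch `m`
the parameter is `b`, and these epochs together cost at most `c j * T`. -/
structure ParameterChoice (k₀ : D₀ → D₀ → ℝ) (σ2 c : Fin K → ℝ) (d N b L κ W : ℝ) (m : ℕ)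
    (β C F V : ℕ → ℝ) : Prop where
  twenty_le : ∀ i, 20 ≤ β i
  cost_pos : ∀ i, 0 < C i
  cover : ∀ i, ∃ S : List (D₀ × Fin K), (S.map fun p => c p.2).sum = C i ∧ ∀ z,
    β i * postVar (fun p q : D₀ × Fin K => k₀ p.1 q.1) (fun p => σ2 p.2) S z ≤ ((1 / 2) ^ i) ^ 2
  early_param : ∀ i ≤ m, β i = b
  early_factor : ∀ i ≤ m, F i = L
  late_factor : ∀ i, m < i → F i = 1 + N * β i / ((2 * d + d ^ 2) * ((1 / 2) ^ i) ^ 2)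
  late_param : ∀ i, m < i → 2 * Real.log (κ * V (i + 1) ^ 2) ≤ β i
  total_zero : V 0 = 0
  total_succ : ∀ i, V (i + 1) = V i + C i * F i
  early_total : V (m + 1) ≤ W

theorem chooseNoiseInput_η {task : Task} {d : ℝ} {β : ℕ → ℝ} (i : ℕ) :
    (chooseNoiseInput k₀ σ2 c task d β).η i = (1 / 2) ^ i := by
  simp [Input.η, chooseNoiseInput]

/-- Early epochs use `b`, the factor `L` and the explicit numbers of queries, whose sum the horizon
condition bounds. As `L ≥ 1`, each number is at most `T`, as their covers require. Late epochs need
only finite budgets, so crude bounds suffice there. -/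
theorem exists_parameterChoice [Fintype D₀] [Nonempty D₀] (hk : (Matrix.of k₀).PosSemidef) (h1 : ∀ x, k₀ x x = 1)
    (hσ : ∀ j, 0 < σ2 j) (hc : ∀ j, 0 < c j) (j : Fin K) {N T m : ℕ} {d ε b L κ : ℝ}
    (hε : 0 < ε) (hd : 0 < d) (hε1 : ε ≤ 4 * (1 + d)) (hT : 1 ≤ T) (hb : 20 ≤ b)
    (hL : L = Real.log (16 * (1 + d) ^ 2 * N * b / (d ^ 2 * ε ^ 2))) (hL1 : 1 ≤ L) (hκ : 0 < κ)
    (hm : (2 : ℝ) ^ m ≤ 8 * ((1 + d) / ε))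
    (hhor : HorizonCondition (σ2 j) (maxInfoGain k₀ (σ2 j) T) b d ε N T) :
    ∃ β C F V : ℕ → ℝ, ParameterChoice k₀ σ2 c d N b L κ (c j * T) m β C F V := by
  set n : ℕ → ℕ := fun i => ⌈2 * maxInfoGain k₀ (σ2 j) T * (σ2 j * b * 4 ^ i + 1 / 2)⌉₊ with hn
  have hL0 : 0 ≤ L := by linarith
  have hsum : (∑ i ∈ Finset.range (m + 1), (n i : ℝ)) * L ≤ T := by
    refine le_trans (mul_le_mul_of_nonneg_right ?_ hL0) (by rw [hL]; exact hhor)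
    exact sum_queries_le (hσ j) hε (by linarith) hε1 hb
      (half_log_le_maxInfoGain hk h1 (hσ j) hT) hm
  have hnT : ∀ i ≤ m, n i ≤ T := by
    intro i hi
    have h2 : (n i : ℝ) ≤ ∑ i ∈ Finset.range (m + 1), (n i : ℝ) :=
      Finset.single_le_sum (f := fun i => (n i : ℝ)) (fun _ _ => Nat.cast_nonneg _)
        (Finset.mem_range.2 (Nat.lt_succ_of_le hi))
    have h3 : (n i : ℝ) ≤ T := by
      refine le_trans ?_ hsum
      exact h2.trans (le_mul_of_one_le_right (Finset.sum_nonneg fun _ _ => Nat.cast_nonneg _) hL1)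
    exact_mod_cast h3
  have hγ0 : 0 < maxInfoGain k₀ (σ2 j) T := lt_of_lt_of_le
    (mul_pos (by norm_num) (Real.log_pos (by linarith [inv_pos.2 (hσ j)])))
    (half_log_le_maxInfoGain hk h1 (hσ j) hT)
  obtain ⟨β, C, F, V, hV0, hV, hp⟩ := exists_budget_sequence
    (p := fun i V β C F => 20 ≤ β ∧ 0 < C ∧
      (∃ S : List (D₀ × Fin K), (S.map fun p => c p.2).sum = C ∧ ∀ z,
        β * postVar (fun p q : D₀ × Fin K => k₀ p.1 q.1) (fun p => σ2 p.2) S z ≤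
          ((1 / 2) ^ i) ^ 2) ∧
      (i ≤ m → β = b ∧ F = L ∧ C = c j * n i) ∧
      (m < i → F = 1 + N * β / ((2 * d + d ^ 2) * ((1 / 2) ^ i) ^ 2) ∧
        2 * Real.log (κ * (V + C * F) ^ 2) ≤ β)) (by
    intro i V
    rcases le_or_gt i m with hi | hi
    · have hσj := hσ j
      have hn0 : (0 : ℝ) < n i := by
        have : 0 < n i := Nat.ceil_pos.2 (by positivity)
        exact_mod_cast this
      exact ⟨b, c j * n i, L, hb, mul_pos (hc j) hn0,
        exists_early_cover hk h1 hσ j hT (by linarith) i (hnT i hi), fun _ => ⟨rfl, rfl, rfl⟩,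
        fun h => absurd hi (not_le.2 h)⟩
    · obtain ⟨β, C, hβ, hC, hS, hlog⟩ := exists_confidence_parameter (N := N)
        (θ := (2 * d + d ^ 2) * ((1 / 2) ^ i) ^ 2) (e := ((1 / 2) ^ i) ^ 2) hk hσ hc j
        (by positivity) (by positivity) hκ (Nat.cast_nonneg N) V
      exact ⟨β, C, _, hβ, hC, hS, fun h => absurd h (not_le.2 hi), fun _ => ⟨rfl, hlog⟩⟩)
  refine ⟨β, C, F, V, fun i => (hp i).1, fun i => (hp i).2.1, fun i => (hp i).2.2.1,
    fun i hi => ((hp i).2.2.2.1 hi).1, fun i hi => ((hp i).2.2.2.1 hi).2.1,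
    fun i hi => ((hp i).2.2.2.2 hi).1, fun i hi => ?_, hV0, hV, ?_⟩
  · rw [hV]
    exact ((hp i).2.2.2.2 hi).2
  · have h2 : ∀ l, V l = ∑ i ∈ Finset.range l, C i * F i := by
      intro l
      induction l with
      | zero => simpa using hV0
      | succ l ih => rw [hV, ih, Finset.sum_range_succ]
    have h3 : ∀ i ∈ Finset.range (m + 1), C i * F i = c j * (n i * L) := by
      intro i hi
      obtain ⟨-, hF, hC⟩ := (hp i).2.2.2.1 (Nat.lt_succ_iff.1 (Finset.mem_range.1 hi))
      rw [hF, hC, mul_assoc]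
    rw [h2, Finset.sum_congr rfl h3, ← Finset.mul_sum, ← Finset.sum_mul]
    exact mul_le_mul_of_nonneg_left hsum (hc j).le

variable {task : Task} {d ε b L κ W : ℝ} {m : ℕ} {β C F V : ℕ → ℝ}

/-- The bound on the initial potential is defined backwards from the factor `F i`, so that the decay
condition is an equality. What remains is that actual potentials respect it: by the previous epoch's
test for early epochs, by the prior variance for the first and the late ones. -/
theorem ParameterChoice.epochBudget [Fintype D₀] (hk : (Matrix.of k₀).PosSemidef) (h1 : ∀ x, k₀ x x = 1)
    (hσ : ∀ j, 0 < σ2 j) (hcard : 0 < Fintype.card (D₀ × Fin K)) (hε : 0 < ε) (hd : 0 < d)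
    (hε1 : ε ≤ 4 * (1 + d)) (hε2 : d * ε ≤ 4 * (1 + d)) (hL1 : 1 ≤ L)
    (hL : L = Real.log (16 * (1 + d) ^ 2 * Fintype.card (D₀ × Fin K) * b / (d ^ 2 * ε ^ 2)))
    (h : ParameterChoice k₀ σ2 c d (Fintype.card (D₀ × Fin K)) b L κ W m β C F V) :
    EpochBudget (chooseNoiseInput k₀ σ2 c task d β) C F
      (fun i => Real.exp (F i - 1) * ((2 * d + d ^ 2) * ((1 / 2) ^ i) ^ 2)) V := by
  set A := chooseNoiseInput k₀ σ2 c task d β with hA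
  have hkA : (Matrix.of A.kernel).PosSemidef := liftKernel_posSemidef hk
  have hnA : ∀ p, 0 < A.noiseVar p := fun p => hσ p.2
  have h1A : ∀ p, A.kernel p p = 1 := fun p => h1 p.1
  have hη : ∀ i, A.η i = (1 / 2) ^ i := chooseNoiseInput_η
  have hβ0 : ∀ i, 0 ≤ A.β i := fun i => le_trans (by norm_num) (h.twenty_le i)
  set N : ℝ := ((Fintype.card (D₀ × Fin K) : ℕ) : ℝ) with hN
  have hN0 : 0 < N := by rw [hN]; exact_mod_cast hcard
  have hb : 20 ≤ b := by rw [← h.early_param 0 (Nat.zero_le m)]; exact h.twenty_le 0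
  obtain ⟨hi0, hi1⟩ := initial_potential_bounds_le hN0 hd hε hε1 hε2 hb hL
  refine ⟨h.cost_pos, fun i => ?_, fun i => ?_, fun i => ?_, ?_, fun i M l hdone => ?_,
    h.total_zero, h.total_succ⟩
  · rw [hη]
    exact h.cover i
  · rcases le_or_gt i m with hi | hi
    · rw [h.early_factor i hi]; exact hL1
    · rw [h.late_factor i hi]
      have := hβ0 i
      have h2 : 0 ≤ N * β i / ((2 * d + d ^ 2) * ((1 / 2) ^ i) ^ 2) :=
        div_nonneg (mul_nonneg hN0.le this) (by positivity)
      linarith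
  · rw [hη, ← mul_assoc, ← Real.exp_add, add_sub_cancel, mul_comm]
    exact le_rfl
  · refine (Input.potential_le_card_mul hkA hnA h1A (hβ0 0) _ _).trans ?_
    have h2 : A.β 0 = b := h.early_param 0 (Nat.zero_le m)
    rw [h2, h.early_factor 0 (Nat.zero_le m)]
    rwa [pow_zero, one_pow, mul_one]
  · rcases le_or_gt (i + 1) m with hi | hi
    · have h2 : A.β (i + 1) = A.β i :=
        (h.early_param _ hi).trans (h.early_param i (by omega)).symm
      refine (Input.potential_le_of_epochDone hkA hnA h1A hd rfl (hβ0 i) h2 hdone).trans ?_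
      rw [h.early_factor _ hi, hη, ← mul_assoc, ← mul_assoc]
      exact mul_le_mul_of_nonneg_right hi1 (sq_nonneg _)
    · refine (Input.potential_le_card_mul hkA hnA h1A (hβ0 _) _ _).trans ?_
      have h2 : A.β (i + 1) = β (i + 1) := rfl
      rw [h.late_factor _ hi, add_sub_cancel_left, h2]
      set θ := (2 * d + d ^ 2) * ((1 / 2 : ℝ) ^ (i + 1)) ^ 2 with hθ
      have hθ0 : 0 < θ := by positivity
      have h3 := Real.add_one_le_exp (N * β (i + 1) / θ)
      calc N * β (i + 1) = N * β (i + 1) / θ * θ := by field_simp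
        _ ≤ Real.exp (N * β (i + 1) / θ) * θ := by gcongr; linarith

end Assembly

end TruVaR

/-! ### The corollary -/

open TruVaR in
theorem corollary3 {D₀ : Type*} [Fintype D₀] [Nonempty D₀] (K : ℕ) (hK : 0 < K)
    (hcard : 2 ≤ Fintype.card (D₀ × Fin K))
    -- the kernel on the points, the noise variances and the costs
    (k₀ : D₀ → D₀ → ℝ) (hpsd : (Matrix.of k₀).PosSemidef) (hnorm : ∀ x, k₀ x x = 1)
    (σ2 : Fin K → ℝ) (hσ2 : ∀ k, 0 < σ2 k)
    (c : Fin K → ℝ) (hc : ∀ k, 0 < c k)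
    (hsub : TruVaR.SubmodularVarReduction
      (fun p q : D₀ × Fin K => k₀ p.1 q.1) (fun p => σ2 p.2))
    -- the accuracy, the error probability and the slack parameter
    (ε : ℝ) (hε : 0 < ε) (δ : ℝ) (hδ : 0 < δ) (hδ1 : δ < 1)
    (δbar : ℝ) (hδbar : 0 < δbar)
    (hε1 : ε ≤ 4 * (1 + δbar)) (hε2 : δbar * ε ≤ 4 * (1 + δbar)) :
    ∃ β : ℕ → ℝ, (∃ b > 0, ∀ i, b ≤ β i) ∧
      ∀ (task : TruVaR.Task) (Ω : Type*) [MeasurableSpace Ω] (P : MeasureTheory.Measure Ω)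
        [MeasureTheory.IsProbabilityMeasure P]
        (f₀ : D₀ → Ω → ℝ) (w : ℕ → Ω → ℝ) (x : ℕ → Ω → D₀ × Fin K) (y : ℕ → Ω → ℝ),
        TruVaR.IsCenteredGP k₀ f₀ P → TruVaR.IsStdNoise w f₀ P →
        TruVaR.IsRun (TruVaR.chooseNoiseInput k₀ σ2 c task δbar β) (fun p => f₀ p.1) w x y →
        ENNReal.ofReal (1 - δ) ≤ P {ω | ∀ t : ℕ,
          (⨅ k, c k * (TruVaR.minHorizon k₀ (Fintype.card (D₀ × Fin K))
              ((⨆ j, c j) / (⨅ j, c j)) δ δbar ε (σ2 k) : ℝ))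
            ≤ TruVaR.cumCost (fun p : D₀ × Fin K => c p.2) (fun s => x s ω) t →
          TruVaR.EpsAccurate (fun p : D₀ × Fin K => f₀ p.1 ω) ε
            ((TruVaR.chooseNoiseInput k₀ σ2 c task δbar β).state
              (fun s => x s ω) (fun s => y s ω) t) task} := by
  have hKne : Nonempty (Fin K) := Fin.pos_iff_nonempty.1 hK
  set cmin := ⨅ j, c j with hcmin
  set cmax := ⨆ j, c j with hcmax
  have hcmin_le : ∀ k, cmin ≤ c k := fun k => ciInf_le (Set.finite_range c).bddBelow k
  have hle_cmax : ∀ k, c k ≤ cmax := fun k => le_ciSup (Set.finite_range c).bddAbove k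
  have hcmin0 : 0 < cmin := by
    obtain ⟨k, hk⟩ := Finite.exists_min c
    exact (hc k).trans_le (le_ciInf hk)
  set N := Fintype.card (D₀ × Fin K) with hN
  set R := cmax / cmin with hR
  have hR1 : 1 ≤ R := by
    obtain ⟨k⟩ := hKne
    rw [hR, one_le_div hcmin0]
    exact (hcmin_le k).trans (hle_cmax k)
  -- All cost estimates refer to the noise level that attains the minimum in the bound, although the
  -- algorithm may query any level.
  obtain ⟨j, hj⟩ := Finite.exists_min fun k => c k * (minHorizon k₀ N R δ δbar ε (σ2 k) : ℝ)
  obtain ⟨hT1, hhor⟩ := minHorizon_spec hpsd hnorm (hσ2 j) hcard hR1 hδ hδ1 hδbar hε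
  set T := minHorizon k₀ N R δ δbar ε (σ2 j) with hT
  have hγ := half_log_le_maxInfoGain hpsd hnorm (hσ2 j) hT1
  have hb := twenty_le_betaT hcard hR1 hδ hδ1 hδbar hε hε1 hε2 (hσ2 j) hγ hT1 hhor
  set b := betaT N R δ T with hbdef
  obtain ⟨m, hm, hm2⟩ := exists_last_epoch (a := 1 + δbar) (by linarith) hε hε1
  obtain ⟨L, hL⟩ : ∃ L, L = Real.log (16 * (1 + δbar) ^ 2 * N * b / (δbar ^ 2 * ε ^ 2)) := ⟨_, rfl⟩
  have hL1 : 1 ≤ L := by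
    rw [hL]
    refine le_trans ?_ (log_two_mul_le hcard hδbar hε hε2 (by linarith))
    rw [Real.le_log_iff_exp_le (by linarith)]
    linarith [Real.exp_one_lt_d9]
  have hN1 : 1 ≤ N := by omega
  have hN0 : (0 : ℝ) < N := by exact_mod_cast hN1
  have hpi := Real.pi_pos
  -- This `κ` turns a cost `V` into the number `V / cmin`, which bounds the number of queries that
  -- cost can pay for.
  obtain ⟨β, C, F, V, h⟩ := exists_parameterChoice (c := c)
    (κ := N * Real.pi ^ 2 / (6 * δ * cmin ^ 2)) hpsd hnorm hσ2 hc j hε hδbar hε1 hT1 hb hL hL1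
    (by positivity) hm2 hhor
  refine ⟨β, ⟨20, by norm_num, h.twenty_le⟩, ?_⟩
  intro task Ω _ P _ f₀ w x y hf hw hrun
  set A := chooseNoiseInput k₀ σ2 c task δbar β with hA
  have hkA : (Matrix.of A.kernel).PosSemidef := liftKernel_posSemidef hpsd
  have hnA : ∀ p, 0 < A.noiseVar p := fun p => hσ2 p.2
  have h1A : ∀ p, A.kernel p p = 1 := fun p => hnorm p.1
  have hE := h.epochBudget (task := task) hpsd hnorm hσ2 hN1 hε hδbar hε1 hε2 hL1 hL
  have hcost : ∀ ω t, (A.state (fun s => x s ω) (fun s => y s ω) t).M.Nonempty →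
      cumCost A.cost (fun s => x s ω) (t + 1) ≤
        V ((A.state (fun s => x s ω) (fun s => y s ω) t).epoch + 1) := fun ω t =>
    hE.cumCost_le hkA hnA h1A (fun p => hc p.2) hsub hδbar (by norm_num [hA, chooseNoiseInput])
      (by norm_num [hA, chooseNoiseInput]) one_pos (b := 20) (by norm_num) h.twenty_le
      (lt_of_lt_of_le (by norm_num [hA, chooseNoiseInput]) (h.twenty_le 0)) (hrun.greedy ω) t
  -- A budget of `c j * T` pays for at most `R * T` queries, which accounts for the factor `R²` in
  -- `betaT`. In late epochs the choice of the parameter covers the requirement.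
  have hparam : ∀ t i : ℕ, ((t : ℝ) + 1) * cmin ≤ V (i + 1) →
      2 * Real.log (N * ((t : ℝ) + 1) ^ 2 * Real.pi ^ 2 / (6 * δ)) ≤ β i := by
    intro t i hti
    rcases le_or_gt i m with hi | hi
    · rw [h.early_param i hi]
      refine betaT_mono_right hN1 hδ (by positivity) ?_
      have h2 := (hE.monotone_total (Nat.succ_le_succ hi)).trans h.early_total
      have h3 : c j * (T : ℝ) ≤ cmax * T :=
        mul_le_mul_of_nonneg_right (hle_cmax j) (Nat.cast_nonneg T)
      rw [hR, div_mul_eq_mul_div, le_div_iff₀ hcmin0]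
      exact hti.trans (h2.trans h3)
    · refine le_trans (mul_le_mul_of_nonneg_left (Real.log_le_log (by positivity) ?_) two_pos.le)
        (h.late_param i hi)
      have h2 := pow_le_pow_left₀ (by positivity) hti 2
      calc N * ((t : ℝ) + 1) ^ 2 * Real.pi ^ 2 / (6 * δ)
          = N * Real.pi ^ 2 / (6 * δ * cmin ^ 2) * (((t : ℝ) + 1) * cmin) ^ 2 := by field_simp
        _ ≤ _ := by gcongr
  have hbad := measure_exists_deviation_le (A := A) hf.lift hw.lift hrun hkA hnA h1A hN1 hδ hδ1
  set bad := {ω | ∃ (t : ℕ) (z : D₀ × Fin K), √(2 * Real.log (N * ((t : ℝ) + 1) ^ 2 *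
      Real.pi ^ 2 / (6 * δ))) * postStd A.kernel A.noiseVar (history (fun t => x t ω) (t + 1)) z <
    |f₀ z.1 ω - postMean A.kernel A.noiseVar (history (fun t => x t ω) (t + 1))
      (fun t => y t ω) z|}
  set good := {ω | ∀ t : ℕ, (⨅ k, c k * (minHorizon k₀ N R δ δbar ε (σ2 k) : ℝ))
      ≤ cumCost (fun p : D₀ × Fin K => c p.2) (fun s => x s ω) t →
    EpsAccurate (fun p : D₀ × Fin K => f₀ p.1 ω) ε
      (A.state (fun s => x s ω) (fun s => y s ω) t) task}
  -- The accuracy event is not shown to be measurable; covering the whole space by it and the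
  -- failure event suffices, by subadditivity of the outer measure.
  have hgood : Set.univ ⊆ good ∪ bad := by
    intro ω _
    by_cases hω : ω ∈ bad
    · exact Or.inr hω
    refine Or.inl fun t ht => ?_
    have hconf : A.ConfidenceValid (fun p => f₀ p.1 ω) (fun s => x s ω) (fun s => y s ω) := by
      intro t hM z
      have h2 : |f₀ z.1 ω - postMean A.kernel A.noiseVar (history (fun t => x t ω) (t + 1))
          (fun t => y t ω) z| ≤ √(2 * Real.log (N * ((t : ℝ) + 1) ^ 2 * Real.pi ^ 2 / (6 * δ))) *
          postStd A.kernel A.noiseVar (history (fun t => x t ω) (t + 1)) z := by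
        by_contra hlt
        exact hω ⟨t, z, not_le.1 hlt⟩
      refine h2.trans (mul_le_mul_of_nonneg_right (Real.sqrt_le_sqrt (hparam t _ ?_))
        (Real.sqrt_nonneg _))
      refine le_trans ?_ (hcost ω t hM)
      have h3 : ∑ _i ∈ Finset.range (t + 1), cmin ≤ cumCost A.cost (fun s => x s ω) (t + 1) :=
        Finset.sum_le_sum fun i _ => hcmin_le _
      rw [Finset.sum_const, Finset.card_range, nsmul_eq_mul] at h3
      push_cast at h3
      exact h3
    refine Input.epsAccurate hconf (m := m) (fun i hi => ?_) (by rw [chooseNoiseInput_η]; exact hm)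
      t fun hM => ?_
    · exact (h.early_param i hi).trans (h.early_param m le_rfl).symm
    -- If points remained in an epoch up to `m`, even the cost after one more query would be within
    -- `c j * T`, although the present cost has already reached it.
    · by_contra hle
      have h2 := hcost ω t hM
      have h3 := (hE.monotone_total (Nat.succ_le_succ (not_lt.1 hle))).trans h.early_total
      have h4 : cumCost A.cost (fun s => x s ω) (t + 1) =
        cumCost A.cost (fun s => x s ω) t + A.cost (x t ω) := Finset.sum_range_succ _ _
      have h5 : 0 < A.cost (x t ω) := hc _
      have h6 : c j * (T : ℝ) ≤ cumCost A.cost (fun s => x s ω) t := (le_ciInf hj).trans ht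
      exact absurd (h2.trans h3) (not_le.2 (by linarith))
  rw [ENNReal.ofReal_sub _ hδ.le, ENNReal.ofReal_one, tsub_le_iff_right]
  calc 1 = P Set.univ := measure_univ.symm
    _ ≤ P (good ∪ bad) := measure_mono hgood
    _ ≤ P good + P bad := measure_union_le _ _
    _ ≤ P good + ENNReal.ofReal δ := by gcongr
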